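/- Let $H$ be a Hermitian operator on a finite-dimensional complex Hilbert space $\mathcal H$, let $|\psi\rangle\in\mathcal H$ be a unit vector that is not an eigenvector of $H$, and consider the clock states $|\psi_t\rangle=e^{-itH}|\psi\rangle$, $t\in\mathbb R$. A probabilistic $n$-to-$m$ cloner is a completely positive, trace non-increasing linear map $\mathcal C$ from operators on $\mathcal H^{\otimes n}$ to operators on $\mathcal H^{\otimes m}$ whose success probability $p_t=\operatorname{Tr}[\mathcal C(\psi_t^{\otimes n})]$, $\psi_t=|\psi_t\rangle\langle\psi_t|$, is positive for all $t$; its fidelity is the worst-case fidelity conditional on success, $\inf_{t}\operatorname{Tr}[\psi_t^{\otimes m}\,\mathcal C(\psi_t^{\otimes n})]/p_t$. It is optimal if its fidelity is maximal among all probabilistic $n$-to-$m$ cloners. In a divide-and-clone strategy from $N$ to $M$ copies, the $N$ input copies are divided into groups of sizes $n_i$ ($\sum_i n_i=N$), an optimal probabilistic $n_i$-to-$m_i$ cloner $\mathcal C_i$ is applied to group $i$ ($\sum_i m_i=M$), and the fidelity of the strategy is the worst-case fidelity, conditional on success, of $\bigotimes_i\mathcal C_i$ with respect to $\psi_t^{\otimes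 M}$. Its interaction size is $k=\max_i\max(n_i,m_i)$. It has group exponent $\beta$ if, as $N\to\infty$ and uniformly in $i$, $n_i=\Theta(N^\beta)$ and $m_i=\Theta(n_iM/N)$. Then optimal probabilistic $n$-to-$m$ cloners exist for all $n,m$. Moreover, let $\delta\ge 0$ and let $M>N$ with $M-N=\Theta(N^{1+\delta})$, along any sequence of input numbers $N\to\infty$ (so $M/N=\Theta(N^\delta)$). 1. For every sequence of divide-and-clone strategies from $N$ to $M$ copies with some group exponent $\beta\in\mathbb R$, the following are equivalent: (a) the fidelity of the strategy converges to $1$ (superreplication is achieved); (b) the group size grows faster than $N^\delta$, i.e. $\min_i n_i/N^\delta\to\infty$; (c) $\beta>\delta$; (d) the interaction size is large compared to $M^2/N^2$, i.e. $M^2/N^2=o(k)$. 2. If $\delta<1$, then for every $\varepsilon>0$ there is a sequence of divisions into groups, with some group exponent $\beta$ and with interaction size $k=O(M^2/N^{2-\varepsilon})$, for which the fidelity of the divide-and-clone strategy converges to $1$ (for any choice of the optimal cloners). -/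

import Mathlib

open Filter Asymptotics

open scoped Matrix ComplexOrder

namespace Superreplication

noncomputable section

/-! ### States

The Hilbert space of one particle is `ℂ^d` for a finite index type `d`. A register of particles
labelled by a finite type `P` has the Hilbert space `(ℂ^d)^{⊗P}`, whose product basis is indexed by
`P → d`; operators on it are matrices indexed by `P → d`. -/

/-- The clock state `|ψ_t⟩ = exp(-i t H) |ψ⟩`. -/
def clockState {d : Type*} [Fintype d] [DecidableEq d] (H : Matrix d d ℂ) (ψ : d → ℂ) (t : ℝ) :
    d → ℂ :=
  (NormedSpace.exp ((-(Complex.I * (t : ℂ))) • H)) *ᵥ ψ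

/-- The product vector `|φ⟩^{⊗P}` of a register with particles labelled by `P`. -/
def tensorPower {d : Type*} (P : Type*) [Fintype P] (φ : d → ℂ) : (P → d) → ℂ :=
  fun a => ∏ j, φ (a j)

/-- The operator `|v⟩⟨v|`. -/
def ketBra {A : Type*} (v : A → ℂ) : Matrix A A ℂ :=
  Matrix.vecMulVec v (star v)

/-- `|ψ_t⟩⟨ψ_t|^{⊗P}`: one perfect copy of the clock state on each particle of the register. -/
def copies {d : Type*} [Fintype d] [DecidableEq d] (H : Matrix d d ℂ) (ψ : d → ℂ)
    (P : Type*) [Fintype P] (t : ℝ) : Matrix (P → d) (P → d) ℂ :=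
  ketBra (tensorPower P (clockState H ψ t))

/-! ### Quantum operations -/

/-- Complete positivity: applying `E` to every block of a positive semidefinite `k × k` block matrix
(that is, applying `id_k ⊗ E`) gives a positive semidefinite matrix, for every `k`. -/
def IsCompletelyPositive {A B : Type*} [Fintype A] [Fintype B]
    (E : Matrix A A ℂ →ₗ[ℂ] Matrix B B ℂ) : Prop :=
  ∀ (k : ℕ) (X : Matrix (Fin k) (Fin k) (Matrix A A ℂ)),
    (Matrix.comp (Fin k) (Fin k) A A ℂ X).PosSemidef →
      (Matrix.comp (Fin k) (Fin k) B B ℂ (X.map E)).PosSemidef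

/-- `E` does not increase the trace of positive semidefinite operators. -/
def IsTraceNonincreasing {A B : Type*} [Fintype A] [Fintype B]
    (E : Matrix A A ℂ →ₗ[ℂ] Matrix B B ℂ) : Prop :=
  ∀ X : Matrix A A ℂ, X.PosSemidef → (E X).trace.re ≤ X.trace.re

/-- Probability that the operation `E` occurs when its input register `P` holds perfect copies of
`|ψ_t⟩`. -/
def successProb {d : Type*} [Fintype d] [DecidableEq d] (H : Matrix d d ℂ) (ψ : d → ℂ)
    {P Q : Type*} [Fintype P] [DecidableEq P] [Fintype Q] [DecidableEq Q]
    (E : Matrix (P → d) (P → d) ℂ →ₗ[ℂ] Matrix (Q → d) (Q → d) ℂ) (t : ℝ) : ℝ :=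
  (E (copies H ψ P t)).trace.re

/-- Fidelity, conditional on success, between the output of `E` for input `|ψ_t⟩^{⊗P}` and the
perfect copies `|ψ_t⟩^{⊗Q}`. -/
def fidelityAt {d : Type*} [Fintype d] [DecidableEq d] (H : Matrix d d ℂ) (ψ : d → ℂ)
    {P Q : Type*} [Fintype P] [DecidableEq P] [Fintype Q] [DecidableEq Q]
    (E : Matrix (P → d) (P → d) ℂ →ₗ[ℂ] Matrix (Q → d) (Q → d) ℂ) (t : ℝ) : ℝ :=
  (copies H ψ Q t * E (copies H ψ P t)).trace.re / successProb H ψ E t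

/-- Worst-case fidelity over all clock states `|ψ_t⟩`, `t ∈ ℝ`. -/
def fidelity {d : Type*} [Fintype d] [DecidableEq d] (H : Matrix d d ℂ) (ψ : d → ℂ)
    {P Q : Type*} [Fintype P] [DecidableEq P] [Fintype Q] [DecidableEq Q]
    (E : Matrix (P → d) (P → d) ℂ →ₗ[ℂ] Matrix (Q → d) (Q → d) ℂ) : ℝ :=
  ⨅ t : ℝ, fidelityAt H ψ E t

/-- A probabilistic `n`-to-`m` cloner for the clock states: the successful branch of a quantum
instrument. It has a positive success probability on every clock state, so that the state
conditional on success is defined. -/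
structure ProbCloner {d : Type*} [Fintype d] [DecidableEq d] (H : Matrix d d ℂ) (ψ : d → ℂ)
    (n m : ℕ) where
  /-- the successful quantum operation -/
  op : Matrix (Fin n → d) (Fin n → d) ℂ →ₗ[ℂ] Matrix (Fin m → d) (Fin m → d) ℂ
  completelyPositive : IsCompletelyPositive op
  traceNonincreasing : IsTraceNonincreasing op
  successProb_pos : ∀ t : ℝ, 0 < successProb H ψ op t

/-- `C` is an optimal probabilistic `n`-to-`m` cloner: it attains the maximum fidelity. -/
def ProbCloner.IsOptimal {d : Type*} [Fintype d] [DecidableEq d] {H : Matrix d d ℂ} {ψ : d → ℂ}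
    {n m : ℕ} (C : ProbCloner H ψ n m) : Prop :=
  ∀ C' : ProbCloner H ψ n m, fidelity H ψ C'.op ≤ fidelity H ψ C.op

/-! ### Divide-and-clone -/

/-- A division of `N` input copies into groups: group `i` receives `inSize i` of the `N` input
copies and has to produce `outSize i` of the `M` output copies. -/
structure Division (N M : ℕ) where
  /-- number of groups -/
  groups : ℕ
  /-- number of input copies in each group -/
  inSize : Fin groups → ℕ
  /-- number of output copies of each group -/
  outSize : Fin groups → ℕ
  sum_inSize : ∑ i, inSize i = N
  sum_outSize : ∑ i, outSize i = M

/-- The largest number of particles on which the cloner of a single group acts. -/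
def Division.interactionSize {N M : ℕ} (D : Division N M) : ℕ :=
  Finset.univ.sup fun i => max (D.inSize i) (D.outSize i)

/-- The tensor product `⨂ i, E i` of linear maps between operators on registers of `n i` and `m i`
particles: the linear map that sends `⨂ i, |a i⟩⟨a' i|` to `⨂ i, E i (|a i⟩⟨a' i|)` for all basis
vectors. Particle `j` of group `i` is labelled `⟨i, j⟩`. -/
def tensorMap {d : Type*} [Fintype d] [DecidableEq d] {g : ℕ} {n m : Fin g → ℕ}
    (E : ∀ i, Matrix (Fin (n i) → d) (Fin (n i) → d) ℂ →ₗ[ℂ]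
      Matrix (Fin (m i) → d) (Fin (m i) → d) ℂ) :
    Matrix ((Σ i, Fin (n i)) → d) ((Σ i, Fin (n i)) → d) ℂ →ₗ[ℂ]
      Matrix ((Σ i, Fin (m i)) → d) ((Σ i, Fin (m i)) → d) ℂ where
  toFun X := Matrix.of fun b b' => ∑ a, ∑ a', X a a' *
    ∏ i, E i (Matrix.single (fun j => a ⟨i, j⟩) (fun j => a' ⟨i, j⟩) 1)
      (fun j => b ⟨i, j⟩) (fun j => b' ⟨i, j⟩)
  map_add' X Y := by
    ext b b'
    simp [add_mul, Finset.sum_add_distrib]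
  map_smul' c X := by
    ext b b'
    simp [Finset.mul_sum, mul_assoc]

/-- Fidelity of the divide-and-clone strategy that applies the cloner `C i` to group `i`: the
fidelity of the joint operation `⨂ i, C i` with respect to perfect copies on all outputs. It is
conditional on the success of all the group cloners. -/
def divideAndCloneFidelity {d : Type*} [Fintype d] [DecidableEq d] {H : Matrix d d ℂ} {ψ : d → ℂ}
    {N M : ℕ} (D : Division N M) (C : ∀ i, ProbCloner H ψ (D.inSize i) (D.outSize i)) : ℝ :=
  fidelity H ψ (tensorMap fun i => (C i).op)

/-- The divisions `D k` of `N k` copies have groups of `Θ(N^β)` input copies each, and every group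
produces its proportionate share `Θ(n · M / N)` of the output, where `n` is its number of inputs.
The constants are uniform over the groups. -/
def HasGroupExponent {N M : ℕ → ℕ} (D : ∀ k, Division (N k) (M k)) (β : ℝ) : Prop :=
  ∃ c c' : ℝ, 0 < c ∧ 0 < c' ∧ ∀ᶠ k in atTop, ∀ i : Fin (D k).groups,
    c * (N k : ℝ) ^ β ≤ (D k).inSize i ∧ ((D k).inSize i : ℝ) ≤ c' * (N k : ℝ) ^ β ∧
    c * ((D k).inSize i * ((M k : ℝ) / N k)) ≤ (D k).outSize i ∧
    ((D k).outSize i : ℝ) ≤ c' * ((D k).inSize i * ((M k : ℝ) / N k))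

/-- The group size grows faster than `N ^ δ`, uniformly over the groups. -/
def GroupsGrowFasterThan {N M : ℕ → ℕ} (D : ∀ k, Division (N k) (M k)) (δ : ℝ) : Prop :=
  ∀ R : ℝ, ∀ᶠ k in atTop, ∀ i : Fin (D k).groups, R * (N k : ℝ) ^ δ ≤ (D k).inSize i

/-- Along `N → ∞`, the numbers `M` of outputs satisfy `M = N (1 + f)` with `f = Θ(N^δ)`, `f > 0`. -/
def HasReplicationExponent (N M : ℕ → ℕ) (δ : ℝ) : Prop :=
  (∀ᶠ k in atTop, N k < M k) ∧
    (fun k => (M k : ℝ) - N k) =Θ[atTop] fun k => (N k : ℝ) ^ (1 + δ)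

end

end Superreplication

open Superreplication

namespace Superreplication

/-! ### Time averages of trigonometric polynomials -/

/-! In an energy eigenbasis, `n` copies of the clock state form a clock state whose energies are
sums of `n` independent single-particle energies with law `w x = normSq (c x)`. Non-eigenstate means
that `w` charges two distinct energies.

The optimal `n`-to-`m` fidelity is the maximum over shifts `μ` of `cloneOverlap`, the weight that
the `m`-copy energy law gives to the `n`-copy spectrum shifted by `μ`. For the upper bound, average
over time: different frequencies decouple, and Cauchy–Schwarz at each frequency costs at most this
weight (`le_of_forall_kraus_fidelity`). The bound is attained by a filter that matches amplitudes on
the shifted spectrum (`exists_probCloner_fidelity_eq`).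

The `m`-copy energy fluctuates on the scale `√m`, while the `n`-copy spectrum has width of order
`n`. If `n < m` and `n ^ 2 / m` is bounded, no shift covers both tails, so the fidelity stays away
from `1` (`exists_cloneOverlap_le`). In general it is at least `1 - card d * exp (-κ n ^ 2 / m)` for
large `n` (`exists_le_cloneOverlap`).

For group exponent `β`, `n ^ 2 / m` is of order `N ^ (β - δ)`. At each time the fidelities of the
groups multiply. If `β > δ`, the total error is at most of order `N * exp (-A N ^ (β - δ))`, which
vanishes; if `β ≤ δ`, a single group with more outputs than inputs already spoils the fidelity. The
other conditions compare exponents, as the interaction size is of order `N ^ (β + δ)` and `M ^ 2 / N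
^ 2` of order `N ^ (2 δ)`. -/

theorem tendsto_average_exp (ω : ℝ) :
    Tendsto (fun T : ℝ => (T : ℂ)⁻¹ * ∫ t in (0 : ℝ)..T, Complex.exp ((ω * Complex.I) * t)) atTop
      (nhds (if ω = 0 then 1 else 0)) := by
  by_cases h : ω = 0
  · subst h
    refine tendsto_const_nhds.congr' ?_
    filter_upwards [eventually_gt_atTop 0] with T hT
    have : (T : ℂ) ≠ 0 := by exact_mod_cast hT.ne'
    simp [this]
  · have hc : (ω * Complex.I : ℂ) ≠ 0 := by simp [h]
    simp only [integral_exp_mul_complex hc, if_neg h]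
    refine squeeze_zero_norm' (a := fun T : ℝ => T⁻¹ * (2 / ‖(ω * Complex.I : ℂ)‖)) ?_ ?_
    · filter_upwards [eventually_gt_atTop 0] with T hT
      rw [norm_mul, norm_inv, Complex.norm_real, Real.norm_of_nonneg hT.le, norm_div]
      gcongr
      refine (norm_sub_le _ _).trans ?_
      have h1 : ‖Complex.exp (ω * Complex.I * T)‖ = 1 := by
        rw [Complex.norm_exp]; simp
      rw [h1]; simp; norm_num
    · simpa using tendsto_inv_atTop_zero.mul_const (2 / ‖(ω * Complex.I : ℂ)‖)

/-- Parseval for almost periodic sums. Since `ω` need not be injective, coefficients of equal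
frequency are added before taking moduli. -/
theorem tendsto_average_normSq {ι : Type*} [Fintype ι] (z : ι → ℂ) (ω : ι → ℝ) :
    Tendsto (fun T : ℝ => T⁻¹ * ∫ t in (0 : ℝ)..T,
        Complex.normSq (∑ i, z i * Complex.exp ((ω i * Complex.I) * t))) atTop
      (nhds (∑ ν ∈ Finset.univ.image ω,
        Complex.normSq (∑ i with ω i = ν, z i))) := by
  have key : Tendsto (fun T : ℝ => ∑ i, ∑ j, (z i * star (z j)) * ((T : ℂ)⁻¹ *
      ∫ t in (0 : ℝ)..T, Complex.exp (((ω i - ω j : ℝ) * Complex.I) * t))) atTop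
      (nhds (∑ i, ∑ j, (z i * star (z j)) * (if ω i - ω j = 0 then 1 else 0))) :=
    tendsto_finsetSum _ fun i _ => tendsto_finsetSum _ fun j _ =>
      (tendsto_average_exp _).const_mul _
  have e2 : (∑ i, ∑ j, (z i * star (z j)) * (if ω i - ω j = 0 then (1 : ℂ) else 0)) =
      ((∑ ν ∈ Finset.univ.image ω, Complex.normSq (∑ i with ω i = ν, z i) : ℝ) : ℂ) := by
    have hrow : ∀ i, (∑ j, (z i * star (z j)) * (if ω i - ω j = 0 then (1 : ℂ) else 0)) =
        z i * star (∑ j with ω j = ω i, z j) := by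
      intro i
      rw [star_sum, Finset.mul_sum, Finset.sum_filter]
      refine Finset.sum_congr rfl fun j _ => ?_
      simp only [sub_eq_zero, mul_ite, mul_one, mul_zero, eq_comm]
    simp_rw [hrow]
    rw [← Finset.sum_fiberwise_of_maps_to (s := Finset.univ) (t := Finset.univ.image ω) (g := ω)
      (fun i _ => Finset.mem_image_of_mem _ (Finset.mem_univ i))]
    push_cast
    refine Finset.sum_congr rfl fun ν _ => ?_
    rw [← Complex.mul_conj, Finset.sum_mul]
    refine Finset.sum_congr rfl fun i hi => ?_
    rw [(Finset.mem_filter.1 hi).2]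
    rfl
  have e1 : ∀ T : ℝ, (∑ i, ∑ j, (z i * star (z j)) * ((T : ℂ)⁻¹ *
      ∫ t in (0 : ℝ)..T, Complex.exp (((ω i - ω j : ℝ) * Complex.I) * t))) =
      ((T⁻¹ * ∫ t in (0 : ℝ)..T,
        Complex.normSq (∑ i, z i * Complex.exp ((ω i * Complex.I) * t)) : ℝ) : ℂ) := by
    intro T
    rw [Complex.ofReal_mul, ← intervalIntegral.integral_ofReal]
    have : ∀ t : ℝ, ((Complex.normSq (∑ i, z i * Complex.exp ((ω i * Complex.I) * t)) : ℝ) : ℂ) =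
        ∑ i, ∑ j, (z i * star (z j)) * Complex.exp (((ω i - ω j : ℝ) * Complex.I) * t) := by
      intro t
      rw [← Complex.mul_conj, map_sum, Finset.sum_mul_sum]
      refine Finset.sum_congr rfl fun i _ => Finset.sum_congr rfl fun j _ => ?_
      rw [map_mul, ← Complex.exp_conj]
      simp only [map_mul, Complex.conj_ofReal, Complex.conj_I]
      rw [mul_mul_mul_comm, ← Complex.exp_add]
      congr 2
      push_cast; ring
    simp_rw [this]
    rw [intervalIntegral.integral_finsetSum
      (fun i _ => Continuous.intervalIntegrable (by fun_prop) _ _), Finset.mul_sum]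
    refine Finset.sum_congr rfl fun i _ => ?_
    rw [intervalIntegral.integral_finsetSum
      (fun i _ => Continuous.intervalIntegrable (by fun_prop) _ _), Finset.mul_sum]
    refine Finset.sum_congr rfl fun j _ => ?_
    rw [intervalIntegral.integral_const_mul]
    push_cast; ring
  simp_rw [e1, e2] at key
  exact (Complex.continuous_re.tendsto _).comp key

theorem normSq_sum_mul_le {ι : Type*} (s : Finset ι) (x y : ι → ℂ) :
    Complex.normSq (∑ i ∈ s, x i * y i) ≤
      (∑ i ∈ s, Complex.normSq (x i)) * ∑ i ∈ s, Complex.normSq (y i) := by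
  simp only [Complex.normSq_eq_norm_sq]
  refine le_trans ?_ (Finset.sum_mul_sq_le_sq_mul_sq s (fun i => ‖x i‖) (fun i => ‖y i‖))
  gcongr
  simpa only [norm_mul] using norm_sum_le s fun i => x i * y i

/-! ### Clock signals in the energy eigenbasis -/

/-- Coordinates, in an energy eigenbasis with energies `e`, of a clock state with amplitudes `c`. -/
noncomputable def clockVec {A : Type*} (e : A → ℝ) (c : A → ℂ) (t : ℝ) : A → ℂ :=
  fun a => c a * Complex.exp ((-e a * Complex.I) * t)

section

variable {A B J : Type*} [Fintype A] [Fintype B] [Fintype J]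
  (eA : A → ℝ) (cA : A → ℂ) (eB : B → ℝ) (cB : B → ℂ)

/-- The weight that a clock state with energies `eB` and amplitudes `cB` gives to the spectrum of
the clock state with energies `eA` and amplitudes `cA`, shifted by `μ`. -/
noncomputable def spectralOverlap (μ : ℝ) : ℝ :=
  open Classical in
  ∑ b with ∃ a, cA a ≠ 0 ∧ eB b = eA a + μ, Complex.normSq (cB b)

theorem spectralOverlap_nonneg (μ : ℝ) : 0 ≤ spectralOverlap eA cA eB cB μ :=
  Finset.sum_nonneg fun _ _ => Complex.normSq_nonneg _

/-- The overlap depends on `μ` only through a subset of the finite type `B`, so it takes finitely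
many values; hence optimal cloners exist. -/
theorem exists_max_spectralOverlap :
    ∃ μ₀, ∀ μ, spectralOverlap eA cA eB cB μ ≤ spectralOverlap eA cA eB cB μ₀ := by
  classical
  have hfin : (Set.range (spectralOverlap eA cA eB cB)).Finite := by
    refine (Set.finite_range fun s : Finset B => ∑ b ∈ s, Complex.normSq (cB b)).subset ?_
    rintro _ ⟨μ, rfl⟩
    exact ⟨_, rfl⟩
  obtain ⟨_, ⟨μ₀, rfl⟩, h⟩ := hfin.exists_maximalFor id _ (Set.range_nonempty _)
  refine ⟨μ₀, fun μ => ?_⟩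
  rcases le_total (spectralOverlap eA cA eB cB μ) (spectralOverlap eA cA eB cB μ₀) with h' | h'
  · exact h'
  · exact h ⟨μ, rfl⟩ h'

/-- The two sums are the time averages of the overlap with the target and of the success
probability. At frequency `ν` only those `b` in the spectrum shifted by `ν` contribute;
Cauchy–Schwarz splits off their weight, at most `F`. -/
theorem normSq_sum_frequency_le (K : Matrix B A ℂ) (F : ℝ)
    (hF : ∀ μ, spectralOverlap eA cA eB cB μ ≤ F) :
    ∑ ν ∈ Finset.univ.image (fun p : B × A => eB p.1 - eA p.2),
        Complex.normSq (∑ p : B × A with eB p.1 - eA p.2 = ν, star (cB p.1) * (K p.1 p.2 * cA p.2)) ≤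
      F * ∑ b, ∑ ν ∈ Finset.univ.image (fun a => -eA a),
        Complex.normSq (∑ a with -eA a = ν, K b a * cA a) := by
  classical
  set k : B → ℝ → ℂ := fun b E => ∑ a with eA a = E, K b a * cA a with hk
  have hF0 : 0 ≤ F := (spectralOverlap_nonneg eA cA eB cB 0).trans (hF 0)
  have h1 : ∀ ν, (∑ p : B × A with eB p.1 - eA p.2 = ν, star (cB p.1) * (K p.1 p.2 * cA p.2)) =
      ∑ b with ∃ a, cA a ≠ 0 ∧ eB b = eA a + ν, star (cB b) * k b (eB b - ν) := by
    intro ν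
    rw [Finset.sum_filter, Fintype.sum_prod_type, Finset.sum_filter]
    refine Finset.sum_congr rfl fun b _ => ?_
    rw [← Finset.sum_filter]
    split_ifs with h
    · rw [hk, Finset.mul_sum]
      refine Finset.sum_congr ?_ fun _ _ => rfl
      ext a
      simp only [Finset.mem_filter, Finset.mem_univ, true_and]
      constructor <;> intro h <;> linarith
    · refine Finset.sum_eq_zero fun a ha => ?_
      have : cA a = 0 := by
        by_contra hne
        exact h ⟨a, hne, by have := (Finset.mem_filter.1 ha).2; simp only at this; linarith⟩
      simp [this]
  have h2 : ∀ ν, Complex.normSq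
      (∑ p : B × A with eB p.1 - eA p.2 = ν, star (cB p.1) * (K p.1 p.2 * cA p.2)) ≤
      F * ∑ b, Complex.normSq (k b (eB b - ν)) := by
    intro ν
    rw [h1]
    refine (normSq_sum_mul_le _ _ _).trans ?_
    refine mul_le_mul ?_ ?_ (Finset.sum_nonneg fun _ _ => Complex.normSq_nonneg _) hF0
    · refine le_trans (le_of_eq ?_) (hF ν)
      simp [spectralOverlap]
    · exact Finset.sum_le_sum_of_subset_of_nonneg (Finset.filter_subset _ _)
        fun _ _ _ => Complex.normSq_nonneg _
  refine (Finset.sum_le_sum fun ν _ => h2 ν).trans ?_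
  rw [← Finset.mul_sum, Finset.sum_comm]
  refine mul_le_mul_of_nonneg_left (Finset.sum_le_sum fun b _ => ?_) hF0
  have h3 : ∀ ν, (∑ a with -eA a = ν, K b a * cA a) = k b (-ν) := by
    intro ν
    refine Finset.sum_congr ?_ fun _ _ => rfl
    ext a
    simp only [Finset.mem_filter, Finset.mem_univ, true_and]
    constructor <;> intro h <;> linarith
  simp_rw [h3]
  generalize (Finset.univ.image fun p : B × A => eB p.1 - eA p.2) = Ω
  -- For fixed `b`, translating by `eB b` turns difference frequencies into input frequencies;
  -- values outside the input spectrum contribute zero.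
  calc ∑ ν ∈ Ω, Complex.normSq (k b (eB b - ν))
      = ∑ ν ∈ Ω.image (fun ν => ν - eB b), Complex.normSq (k b (-ν)) := by
        rw [Finset.sum_image (fun x _ y _ h => by simpa using h)]
        simp
    _ ≤ _ := by
        rw [← Finset.sum_filter_add_sum_filter_not (Ω.image fun ν => ν - eB b)
          (fun ν => ν ∈ Finset.univ.image fun a => -eA a)]
        rw [add_eq_left.2]
        · refine Finset.sum_le_sum_of_subset_of_nonneg ?_ fun _ _ _ => Complex.normSq_nonneg _
          intro ν hν
          exact (Finset.mem_filter.1 hν).2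
        · refine Finset.sum_eq_zero fun ν hν => ?_
          have hν := (Finset.mem_filter.1 hν).2
          have : k b (-ν) = 0 := by
            refine Finset.sum_eq_zero fun a ha => absurd ?_ hν
            have := (Finset.mem_filter.1 ha).2
            exact Finset.mem_image.2 ⟨a, Finset.mem_univ _, by linarith⟩
          simp [this]

/-- No operation that succeeds at some time can have fidelity more than `F` at all times, where `F`
bounds the spectral overlaps. -/
theorem le_of_forall_kraus_fidelity (K : J → Matrix B A ℂ) (F f : ℝ)
    (hF : ∀ μ, spectralOverlap eA cA eB cB μ ≤ F)
    (hf : ∀ t, f * ∑ j, ∑ b, Complex.normSq ((K j *ᵥ clockVec eA cA t) b) ≤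
      ∑ j, Complex.normSq (star (clockVec eB cB t) ⬝ᵥ (K j *ᵥ clockVec eA cA t)))
    (t₀ : ℝ) (hpos : 0 < ∑ j, ∑ b, Complex.normSq ((K j *ᵥ clockVec eA cA t₀) b)) : f ≤ F := by
  classical
  set p : ℝ := ∑ j, ∑ b, ∑ ν ∈ Finset.univ.image (fun a => -eA a),
    Complex.normSq (∑ a with -eA a = ν, K j b a * cA a) with hp
  have e1 : ∀ j b (t : ℝ), (K j *ᵥ clockVec eA cA t) b =
      ∑ a, (K j b a * cA a) * Complex.exp ((((-eA a : ℝ) : ℂ) * Complex.I) * t) := by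
    intro j b t
    simp [Matrix.mulVec, dotProduct, clockVec, mul_assoc]
  have e2 : ∀ j (t : ℝ), star (clockVec eB cB t) ⬝ᵥ (K j *ᵥ clockVec eA cA t) =
      ∑ p : B × A, (star (cB p.1) * (K j p.1 p.2 * cA p.2)) *
        Complex.exp ((((eB p.1 - eA p.2 : ℝ) : ℂ) * Complex.I) * t) := by
    intro j t
    rw [Fintype.sum_prod_type]
    simp only [dotProduct]
    refine Finset.sum_congr rfl fun b _ => ?_
    rw [e1, Finset.mul_sum]
    refine Finset.sum_congr rfl fun a _ => ?_
    simp only [Pi.star_apply, clockVec, star_mul', RCLike.star_def, ← Complex.exp_conj, map_mul,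
      map_neg, Complex.conj_ofReal, Complex.conj_I]
    rw [show ((eB b - eA a : ℝ) : ℂ) * Complex.I * t =
      -eB b * -Complex.I * t + ((-eA a : ℝ) : ℂ) * Complex.I * t by push_cast; ring, Complex.exp_add]
    ring
  have l1 : Tendsto (fun T : ℝ => ∑ j, ∑ b, T⁻¹ * ∫ t in (0 : ℝ)..T,
      Complex.normSq ((K j *ᵥ clockVec eA cA t) b)) atTop (nhds p) := by
    refine tendsto_finsetSum _ fun j _ => tendsto_finsetSum _ fun b _ => ?_
    simp_rw [e1]
    exact tendsto_average_normSq _ _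
  have l2 := tendsto_finsetSum (Finset.univ : Finset J) fun j _ => tendsto_average_normSq
    (fun p : B × A => star (cB p.1) * (K j p.1 p.2 * cA p.2)) (fun p => eB p.1 - eA p.2)
  simp_rw [← e2] at l2
  have c1 : ∀ j b, Continuous fun t : ℝ => Complex.normSq ((K j *ᵥ clockVec eA cA t) b) := by
    intro j b
    simp_rw [e1]
    exact Complex.continuous_normSq.comp (by fun_prop)
  have c2 : ∀ j, Continuous fun t : ℝ => Complex.normSq
      (star (clockVec eB cB t) ⬝ᵥ (K j *ᵥ clockVec eA cA t)) := by
    intro j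
    simp_rw [e2]
    exact Complex.continuous_normSq.comp (by fun_prop)
  have hle := le_of_tendsto_of_tendsto (l1.const_mul f) l2 (by
    filter_upwards [eventually_gt_atTop 0] with T hT
    simp_rw [← Finset.mul_sum]
    rw [mul_left_comm]
    refine mul_le_mul_of_nonneg_left ?_ (inv_nonneg.2 hT.le)
    simp_rw [← intervalIntegral.integral_finsetSum
      (fun b (_ : b ∈ Finset.univ) => (c1 _ b).intervalIntegrable 0 T)]
    rw [← intervalIntegral.integral_finsetSum
      (fun j _ => (continuous_finsetSum _ fun b _ => c1 j b).intervalIntegrable 0 T),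
      ← intervalIntegral.integral_finsetSum (fun j _ => (c2 j).intervalIntegrable 0 T),
      ← intervalIntegral.integral_const_mul]
    refine intervalIntegral.integral_mono_on hT.le
      (Continuous.intervalIntegrable (continuous_const.mul <| continuous_finsetSum _ fun j _ =>
        continuous_finsetSum _ fun b _ => c1 j b) _ _)
      (Continuous.intervalIntegrable (continuous_finsetSum _ fun j _ => c2 j) _ _)
      fun t _ => hf t)
  have hle2 : f * p ≤ F * p := by
    refine hle.trans ?_
    rw [hp, Finset.mul_sum]
    exact Finset.sum_le_sum fun j _ => normSq_sum_frequency_le eA cA eB cB (K j) F hF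
  -- If the mean success probability vanished, all Fourier coefficients would vanish, and with them
  -- the probability at `t₀`.
  have hp0 : 0 < p := by
    have hn : ∀ j b, 0 ≤ ∑ ν ∈ Finset.univ.image (fun a => -eA a),
        Complex.normSq (∑ a with -eA a = ν, K j b a * cA a) :=
      fun j b => Finset.sum_nonneg fun _ _ => Complex.normSq_nonneg _
    refine lt_of_le_of_ne (Finset.sum_nonneg fun j _ => Finset.sum_nonneg fun b _ => hn j b) ?_
    intro h0
    refine hpos.ne' (Finset.sum_eq_zero fun j _ => Finset.sum_eq_zero fun b _ => ?_)
    have h1 := (Finset.sum_eq_zero_iff_of_nonneg (fun j _ => Finset.sum_nonneg fun b _ =>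
      hn j b)).1 h0.symm j (Finset.mem_univ _)
    have h2 := (Finset.sum_eq_zero_iff_of_nonneg (fun b _ => hn j b)).1 h1 b (Finset.mem_univ _)
    have h3 := (Finset.sum_eq_zero_iff_of_nonneg (fun _ _ => Complex.normSq_nonneg _)).1 h2
    rw [map_eq_zero, e1, ← Finset.sum_fiberwise_of_maps_to (s := Finset.univ)
      (t := Finset.univ.image fun a => -eA a) (g := fun a => -eA a)
      (fun i _ => Finset.mem_image_of_mem _ (Finset.mem_univ i))]
    refine Finset.sum_eq_zero fun ν hν => ?_
    have h4 := h3 ν hν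
    rw [map_eq_zero] at h4
    rw [Finset.sum_congr rfl (g := fun a => (K j b a * cA a) * Complex.exp ((ν * Complex.I) * t₀))
      (fun a ha => by rw [(Finset.mem_filter.1 ha).2]), ← Finset.sum_mul, h4, zero_mul]
  exact le_of_mul_le_mul_right hle2 hp0

end

/-! ### Kraus operators -/

section Kraus

variable {A B : Type*} [Fintype A] [Fintype B]

omit [Fintype B] in
theorem linearMap_apply_eq_sum [DecidableEq A] (E : Matrix A A ℂ →ₗ[ℂ] Matrix B B ℂ)
    (X : Matrix A A ℂ) (b b' : B) :
    E X b b' = ∑ a, ∑ a', X a a' * E (Matrix.single a a' 1) b b' := by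
  have hX : E X = ∑ a, ∑ a', X a a' • E (Matrix.single a a' 1) := by
    conv_lhs => rw [Matrix.matrix_eq_sum_single X]
    simp only [map_sum]
    refine Finset.sum_congr rfl fun a _ => Finset.sum_congr rfl fun a' _ => ?_
    rw [← map_smul, Matrix.smul_single, smul_eq_mul, mul_one]
  rw [hX]
  simp only [Matrix.sum_apply, Matrix.smul_apply, smul_eq_mul]

/-- Complete positivity is applied to the unnormalised maximally entangled projector. -/
theorem IsCompletelyPositive.choi_posSemidef [DecidableEq A]
    {E : Matrix A A ℂ →ₗ[ℂ] Matrix B B ℂ} (hE : IsCompletelyPositive E) :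
    (Matrix.of fun (p q : A × B) => E (Matrix.single p.1 q.1 1) p.2 q.2).PosSemidef := by
  let f := Fintype.equivFin A
  let X : Matrix (Fin (Fintype.card A)) (Fin (Fintype.card A)) (Matrix A A ℂ) :=
    Matrix.of fun i j => Matrix.single (f.symm i) (f.symm j) 1
  have hX : (Matrix.comp _ _ A A ℂ X).PosSemidef := by
    have : Matrix.comp _ _ A A ℂ X = Matrix.vecMulVec
        (fun p : Fin (Fintype.card A) × A => if f.symm p.1 = p.2 then (1 : ℂ) else 0)
        (star fun p : Fin (Fintype.card A) × A => if f.symm p.1 = p.2 then (1 : ℂ) else 0) := by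
      ext ⟨i, a⟩ ⟨j, b⟩
      simp only [X, Matrix.comp_apply, Matrix.of_apply, Matrix.vecMulVec_apply,
        Matrix.single_apply, Pi.star_apply]
      split_ifs <;> simp_all
    rw [this]
    exact Matrix.posSemidef_vecMulVec_self_star _
  have h := (hE _ X hX).submatrix (fun p : A × B => (f p.1, p.2))
  convert h using 1
  ext p q
  simp [X, Matrix.comp_apply]

-- Factor the Choi matrix as `star L * L`; each row of `L`, conjugated and reshaped, is a Kraus
-- operator.
open scoped MatrixOrder Matrix.Norms.L2Operator in
theorem IsCompletelyPositive.exists_kraus [DecidableEq A] [DecidableEq B]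
    {E : Matrix A A ℂ →ₗ[ℂ] Matrix B B ℂ} (hE : IsCompletelyPositive E) :
    ∃ K : A × B → Matrix B A ℂ, ∀ X, E X = ∑ j, K j * X * (K j)ᴴ := by
  obtain ⟨L, hL⟩ := CStarAlgebra.nonneg_iff_eq_star_mul_self.mp hE.choi_posSemidef.nonneg
  refine ⟨fun j => Matrix.of fun b a => star (L j (a, b)), fun X => ?_⟩
  ext b b'
  have hc : ∀ a a', E (Matrix.single a a' 1) b b' = ∑ j, star (L j (a, b)) * L j (a', b') := by
    intro a a'
    have := congr_fun (congr_fun hL (a, b)) (a', b')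
    simpa [Matrix.mul_apply, Matrix.star_eq_conjTranspose] using this
  rw [linearMap_apply_eq_sum]
  simp only [Matrix.sum_apply, hc, Matrix.mul_apply, Matrix.of_apply,
    Matrix.conjTranspose_apply, star_star, Finset.mul_sum, Finset.sum_mul]
  rw [Finset.sum_comm]
  conv_lhs => enter [2, a]; rw [Finset.sum_comm]
  rw [Finset.sum_comm]
  refine Finset.sum_congr rfl fun j _ => ?_
  refine Finset.sum_congr rfl fun a _ => Finset.sum_congr rfl fun a' _ => ?_
  ring

/-- The operation `X ↦ K X K†`. -/
def conjMap (K : Matrix B A ℂ) : Matrix A A ℂ →ₗ[ℂ] Matrix B B ℂ where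
  toFun X := K * X * Kᴴ
  map_add' X Y := by simp [Matrix.mul_add, Matrix.add_mul]
  map_smul' c X := by simp

omit [Fintype B] in
theorem conjMap_apply (K : Matrix B A ℂ) (X : Matrix A A ℂ) : conjMap K X = K * X * Kᴴ := rfl

theorem isCompletelyPositive_conjMap (K : Matrix B A ℂ) : IsCompletelyPositive (conjMap K) := by
  intro k X hX
  -- This is `1 ⊗ K`.
  let L : Matrix (Fin k × B) (Fin k × A) ℂ := Matrix.of fun p q => if p.1 = q.1 then K p.2 q.2 else 0
  have : Matrix.comp (Fin k) (Fin k) B B ℂ (X.map (conjMap K)) =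
      L * Matrix.comp (Fin k) (Fin k) A A ℂ X * Lᴴ := by
    ext ⟨i, b⟩ ⟨j, b'⟩
    simp [Matrix.comp_apply, conjMap_apply, Matrix.mul_apply, L, Fintype.sum_prod_type,
      apply_ite (star : ℂ → ℂ), ite_mul, mul_ite, Finset.sum_ite_irrel]
  rw [this]
  exact hX.mul_mul_conjTranspose_same L

theorem trace_ketBra_mul_conj (u : B → ℂ) (v : A → ℂ) (K : Matrix B A ℂ) :
    (ketBra u * (K * ketBra v * Kᴴ)).trace = Complex.normSq (star u ⬝ᵥ (K *ᵥ v)) := by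
  have : K * ketBra v * Kᴴ = ketBra (K *ᵥ v) := by
    simp [ketBra, Matrix.mul_vecMulVec, Matrix.vecMulVec_mul, Matrix.star_mulVec]
  rw [this, ketBra, ketBra, Matrix.vecMulVec_mul_vecMulVec, Matrix.trace_vecMulVec,
    Complex.normSq_eq_conj_mul_self, dotProduct_smul, smul_eq_mul, mul_comm]
  congr 1
  simp [dotProduct, mul_comm]

theorem trace_conj_ketBra (v : A → ℂ) (K : Matrix B A ℂ) :
    (K * ketBra v * Kᴴ).trace = ((∑ b, Complex.normSq ((K *ᵥ v) b) : ℝ) : ℂ) := by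
  have : K * ketBra v * Kᴴ = ketBra (K *ᵥ v) := by
    simp [ketBra, Matrix.mul_vecMulVec, Matrix.vecMulVec_mul, Matrix.star_mulVec]
  rw [this, ketBra, Matrix.trace_vecMulVec]
  simp [dotProduct, Complex.mul_conj]

-- Any filter becomes trace non-increasing after rescaling, which leaves conditional fidelities
-- unchanged. The squared Hilbert–Schmidt norm of `K` suffices; adding `1` covers `K = 0`.
open scoped MatrixOrder Matrix.Norms.L2Operator in
theorem exists_trace_conj_le [DecidableEq A] (K : Matrix B A ℂ) :
    ∃ r : ℝ, 0 < r ∧ ∀ X : Matrix A A ℂ, X.PosSemidef →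
      r * (K * X * Kᴴ).trace.re ≤ X.trace.re := by
  have hpos : 0 < (∑ b, ∑ a, Complex.normSq (K b a)) + 1 :=
    add_pos_of_nonneg_of_pos (Finset.sum_nonneg fun b _ => Finset.sum_nonneg fun a _ =>
      Complex.normSq_nonneg _) one_pos
  refine ⟨((∑ b, ∑ a, Complex.normSq (K b a)) + 1)⁻¹, inv_pos.2 hpos, fun X hX => ?_⟩
  obtain ⟨Y, rfl⟩ := CStarAlgebra.nonneg_iff_eq_star_mul_self.mp hX.nonneg
  have h1 : (K * (star Y * Y) * Kᴴ).trace.re =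
      ∑ b, ∑ j, Complex.normSq (∑ a, K b a * star (Y j a)) := by
    have : K * (star Y * Y) * Kᴴ = (K * Yᴴ) * (K * Yᴴ)ᴴ := by
      simp [Matrix.mul_assoc, Matrix.star_eq_conjTranspose]
    rw [this, Matrix.trace, Complex.re_sum]
    refine Finset.sum_congr rfl fun b _ => ?_
    rw [Matrix.diag_apply, Matrix.mul_apply, Complex.re_sum]
    refine Finset.sum_congr rfl fun j _ => ?_
    rw [Matrix.conjTranspose_apply, ← starRingEnd_apply, Complex.mul_conj, Complex.ofReal_re,
      Matrix.mul_apply]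
    rfl
  have h2 : (star Y * Y).trace.re = ∑ j, ∑ a, Complex.normSq (Y j a) := by
    rw [Matrix.trace, Complex.re_sum, Finset.sum_comm]
    refine Finset.sum_congr rfl fun a _ => ?_
    rw [Matrix.diag_apply, Matrix.mul_apply, Complex.re_sum]
    refine Finset.sum_congr rfl fun j _ => ?_
    rw [Matrix.star_apply, mul_comm, ← starRingEnd_apply, Complex.mul_conj, Complex.ofReal_re]
  rw [h1, h2, inv_mul_le_iff₀ hpos]
  calc ∑ b, ∑ j, Complex.normSq (∑ a, K b a * star (Y j a))
      ≤ ∑ b, ∑ j, (∑ a, Complex.normSq (K b a)) * ∑ a, Complex.normSq (Y j a) := by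
        gcongr with b _ j _
        refine (normSq_sum_mul_le _ _ _).trans_eq ?_
        simp
    _ = (∑ b, ∑ a, Complex.normSq (K b a)) * ∑ j, ∑ a, Complex.normSq (Y j a) := by
        rw [Finset.sum_mul_sum]
    _ ≤ _ := by
        gcongr
        · exact Finset.sum_nonneg fun j _ => Finset.sum_nonneg fun a _ => Complex.normSq_nonneg _
        · linarith

end Kraus

/-! ### Tensor products of operations -/

section Tensor

variable {d : Type*} [Fintype d] [DecidableEq d] {g : ℕ} {n m : Fin g → ℕ}

omit [DecidableEq d] in
theorem sum_sigma_pi {k : Fin g → ℕ} (f : ∀ i, (Fin (k i) → d) → ℂ) :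
    ∑ a : (Σ i, Fin (k i)) → d, ∏ i, f i (fun j => a ⟨i, j⟩) = ∏ i, ∑ a, f i a := by
  rw [Fintype.prod_sum]
  exact Fintype.sum_equiv (Equiv.piCurry fun _ _ => d) _ _ fun a => rfl

theorem tensorMap_apply_prod
    (E : ∀ i, Matrix (Fin (n i) → d) (Fin (n i) → d) ℂ →ₗ[ℂ]
      Matrix (Fin (m i) → d) (Fin (m i) → d) ℂ)
    (X : ∀ i, Matrix (Fin (n i) → d) (Fin (n i) → d) ℂ) :
    tensorMap E (Matrix.of fun a a' => ∏ i, X i (fun j => a ⟨i, j⟩) (fun j => a' ⟨i, j⟩)) =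
      Matrix.of fun b b' => ∏ i, E i (X i) (fun j => b ⟨i, j⟩) (fun j => b' ⟨i, j⟩) := by
  ext b b'
  simp only [tensorMap, LinearMap.coe_mk, AddHom.coe_mk, Matrix.of_apply,
    ← Finset.prod_mul_distrib]
  simp_rw [linearMap_apply_eq_sum (E _) (X _)]
  rw [← sum_sigma_pi]
  refine Finset.sum_congr rfl fun a _ => ?_
  rw [← sum_sigma_pi]

theorem copies_sigma (H : Matrix d d ℂ) (ψ : d → ℂ) (k : Fin g → ℕ) (t : ℝ) :
    copies H ψ (Σ i, Fin (k i)) t = Matrix.of fun a a' =>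
      ∏ i, copies H ψ (Fin (k i)) t (fun j => a ⟨i, j⟩) (fun j => a' ⟨i, j⟩) := by
  ext a a'
  simp [copies, ketBra, Matrix.vecMulVec_apply, tensorPower, Fintype.prod_sigma,
    Finset.prod_mul_distrib]

omit [DecidableEq d] in
theorem trace_of_prod (X : ∀ i, Matrix (Fin (m i) → d) (Fin (m i) → d) ℂ) :
    (Matrix.of fun (a a' : (Σ i, Fin (m i)) → d) =>
      ∏ i, X i (fun j => a ⟨i, j⟩) (fun j => a' ⟨i, j⟩)).trace = ∏ i, (X i).trace := by
  simp only [Matrix.trace, Matrix.diag_apply, Matrix.of_apply]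
  rw [← sum_sigma_pi]

omit [DecidableEq d] in
theorem of_prod_mul_of_prod (X Y : ∀ i, Matrix (Fin (m i) → d) (Fin (m i) → d) ℂ) :
    (Matrix.of fun (a a' : (Σ i, Fin (m i)) → d) =>
        ∏ i, X i (fun j => a ⟨i, j⟩) (fun j => a' ⟨i, j⟩)) *
      (Matrix.of fun (a a' : (Σ i, Fin (m i)) → d) =>
        ∏ i, Y i (fun j => a ⟨i, j⟩) (fun j => a' ⟨i, j⟩)) =
    Matrix.of fun (a a' : (Σ i, Fin (m i)) → d) =>
        ∏ i, (X i * Y i) (fun j => a ⟨i, j⟩) (fun j => a' ⟨i, j⟩) := by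
  ext a a'
  simp only [Matrix.mul_apply, Matrix.of_apply]
  rw [← sum_sigma_pi]
  simp only [Finset.prod_mul_distrib]

/-- Factorisation holds at each fixed time, not for the infimum over times. The traces must be real
because `re` is not multiplicative. -/
theorem fidelityAt_tensorMap (H : Matrix d d ℂ) (ψ : d → ℂ)
    (E : ∀ i, Matrix (Fin (n i) → d) (Fin (n i) → d) ℂ →ₗ[ℂ]
      Matrix (Fin (m i) → d) (Fin (m i) → d) ℂ) (t : ℝ)
    (h1 : ∀ i, (E i (copies H ψ (Fin (n i)) t)).trace.im = 0)
    (h2 : ∀ i, (copies H ψ (Fin (m i)) t * E i (copies H ψ (Fin (n i)) t)).trace.im = 0) :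
    fidelityAt H ψ (tensorMap E) t = ∏ i, fidelityAt H ψ (E i) t := by
  have hre : ∀ z : Fin g → ℂ, (∀ i, (z i).im = 0) → (∏ i, z i).re = ∏ i, (z i).re := by
    intro z hz
    have : ∀ i, z i = ((z i).re : ℂ) := fun i => Complex.ext rfl (by simp [hz i])
    conv_lhs => enter [1, 2, i]; rw [this i]
    rw [← Complex.ofReal_prod, Complex.ofReal_re]
  simp only [fidelityAt, successProb, Finset.prod_div_distrib]
  rw [← hre _ h1, ← hre _ h2, copies_sigma, copies_sigma, tensorMap_apply_prod, trace_of_prod,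
    of_prod_mul_of_prod, trace_of_prod]

end Tensor

/-! ### The clock states in the energy eigenbasis -/

section Spectral

variable {d : Type*} [Fintype d] [DecidableEq d]

theorem exists_clockState_eq {H : Matrix d d ℂ} (hH : H.IsHermitian) {ψ : d → ℂ}
    (hψ : star ψ ⬝ᵥ ψ = 1) (hclock : ∀ e : ℂ, H *ᵥ ψ ≠ e • ψ) :
    ∃ (U : Matrix d d ℂ) (e : d → ℝ) (c : d → ℂ), Uᴴ * U = 1 ∧
      (∀ t, clockState H ψ t = U *ᵥ clockVec e c t) ∧ ∑ x, Complex.normSq (c x) = 1 ∧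
      ∃ x y, c x ≠ 0 ∧ c y ≠ 0 ∧ e x < e y := by
  set U : Matrix d d ℂ := (hH.eigenvectorUnitary : Matrix d d ℂ) with hU
  set e := hH.eigenvalues with he
  have h1 : Uᴴ * U = 1 := Unitary.coe_star_mul_self hH.eigenvectorUnitary
  have h2 : U * Uᴴ = 1 := mul_eq_one_comm.1 h1
  have hH' : H = U * Matrix.diagonal (fun x => (e x : ℂ)) * Uᴴ := by
    have := hH.spectral_theorem
    rw [Unitary.conjStarAlgAut_apply] at this
    exact this
  set c := Uᴴ *ᵥ ψ with hc
  have hψc : ψ = U *ᵥ c := by rw [hc, Matrix.mulVec_mulVec, h2, Matrix.one_mulVec]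
  have hsum : ∑ x, Complex.normSq (c x) = 1 := by
    have : star c ⬝ᵥ c = 1 := by
      rw [hc, Matrix.star_mulVec, ← Matrix.dotProduct_mulVec, Matrix.mulVec_mulVec,
        Matrix.conjTranspose_conjTranspose, h2, Matrix.one_mulVec, hψ]
    have h3 : ((∑ x, Complex.normSq (c x) : ℝ) : ℂ) = 1 := by
      rw [← this]
      simp [dotProduct, Complex.normSq_eq_conj_mul_self]
    exact_mod_cast h3
  refine ⟨U, e, c, h1, fun t => ?_, hsum, ?_⟩
  · have hinv : U⁻¹ = Uᴴ := Matrix.inv_eq_left_inv h1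
    have hunit : IsUnit U := ⟨⟨U, Uᴴ, h2, h1⟩, rfl⟩
    have hexp : NormedSpace.exp ((-(Complex.I * (t : ℂ))) • H) =
        U * Matrix.diagonal (fun x => Complex.exp ((-e x * Complex.I) * t)) * Uᴴ := by
      have : (-(Complex.I * (t : ℂ))) • H =
          U * Matrix.diagonal (fun x => (-e x * Complex.I) * t) * U⁻¹ := by
        rw [hinv]
        conv_lhs => rw [hH', ← Matrix.smul_mul, ← Matrix.mul_smul, ← Matrix.diagonal_smul]
        congr 3
        ext x
        simp
        ring
      rw [this, Matrix.exp_conj _ _ hunit, Matrix.exp_diagonal, hinv]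
      congr 3
      ext x
      rw [Pi.coe_exp, Complex.exp_eq_exp_ℂ]
    rw [clockState, hexp, ← Matrix.mulVec_mulVec, ← hc, ← Matrix.mulVec_mulVec]
    congr 1
    ext x
    rw [Matrix.mulVec_diagonal, clockVec, mul_comm]
  -- Otherwise all energies with nonzero amplitude coincide and `ψ` is an eigenvector.
  · by_contra hcon
    push Not at hcon
    obtain ⟨x, hx⟩ : ∃ x, c x ≠ 0 := by
      by_contra h
      push Not at h
      simp [h] at hsum
    refine hclock (e x) ?_
    have : Matrix.diagonal (fun x => (e x : ℂ)) *ᵥ c = (e x : ℂ) • c := by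
      ext y
      rw [Matrix.mulVec_diagonal, Pi.smul_apply, smul_eq_mul]
      by_cases hy : c y = 0
      · simp [hy]
      · rw [le_antisymm (hcon x y hx hy) (hcon y x hy hx)]
    rw [hH', ← Matrix.mulVec_mulVec, ← hc, ← Matrix.mulVec_mulVec, this, Matrix.mulVec_smul,
      ← hψc]

end Spectral

/-! ### Tensor powers in the energy eigenbasis -/

section Power

variable {d : Type*} [Fintype d] [DecidableEq d] (P : Type*) [Fintype P] [DecidableEq P]

/-- The tensor power `U^{⊗P}` of a matrix. -/
def powerMatrix (U : Matrix d d ℂ) : Matrix (P → d) (P → d) ℂ :=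
  Matrix.of fun b a => ∏ j, U (b j) (a j)

theorem powerMatrix_conjTranspose_mul_self {U : Matrix d d ℂ} (hU : Uᴴ * U = 1) :
    (powerMatrix P U)ᴴ * powerMatrix P U = 1 := by
  ext a a'
  have h : ∀ x y, ∑ z, star (U z x) * U z y = if x = y then 1 else 0 := by
    intro x y
    have := congr_fun (congr_fun hU x) y
    simpa [Matrix.mul_apply, Matrix.one_apply] using this
  simp only [Matrix.mul_apply, Matrix.conjTranspose_apply, powerMatrix, Matrix.of_apply, star_prod,
    ← Finset.prod_mul_distrib]
  rw [← Fintype.prod_sum fun (j : P) z => star (U z (a j)) * U z (a' j)]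
  simp only [h, Matrix.one_apply, Finset.prod_ite_zero, Finset.prod_const_one, funext_iff,
    Finset.mem_univ, true_implies]

/-- The total of the energies of the particles of a register. -/
def totalEnergy {d P : Type*} [Fintype P] (e : d → ℝ) (a : P → d) : ℝ := ∑ j, e (a j)

/-- The amplitude of a product basis vector. -/
def totalAmplitude {d P : Type*} [Fintype P] (c : d → ℂ) (a : P → d) : ℂ := ∏ j, c (a j)

-- Exponentials multiply, so a register of copies is again a clock with additive energies, to which
-- the general overlap bound applies.
omit [DecidableEq d] in
theorem tensorPower_mulVec_clockVec (U : Matrix d d ℂ) (e : d → ℝ) (c : d → ℂ) (t : ℝ) :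
    tensorPower P (U *ᵥ clockVec e c t) =
      powerMatrix P U *ᵥ clockVec (totalEnergy e) (totalAmplitude c) t := by
  ext b
  simp only [tensorPower, Matrix.mulVec, dotProduct]
  rw [Fintype.prod_sum]
  refine Finset.sum_congr rfl fun a _ => ?_
  simp only [powerMatrix, Matrix.of_apply, clockVec, totalEnergy, totalAmplitude,
    Finset.prod_mul_distrib, ← Complex.exp_sum]
  push_cast
  simp only [Finset.sum_mul, Finset.sum_neg_distrib, neg_mul]

omit [DecidableEq d] in
theorem sum_normSq_totalAmplitude {c : d → ℂ} (hc : ∑ x, Complex.normSq (c x) = 1) :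
    ∑ a : P → d, Complex.normSq (totalAmplitude c a) = 1 := by
  simp only [totalAmplitude, map_prod]
  rw [← Fintype.prod_sum fun (_ : P) x => Complex.normSq (c x)]
  simp [hc]

end Power

/-! ### Norms and traces on pure states -/

section Isometry

variable {A B : Type*} [Fintype A] [Fintype B]

theorem sum_normSq_mulVec [DecidableEq A] {W : Matrix B A ℂ} (hW : Wᴴ * W = 1) (x : A → ℂ) :
    ∑ b, Complex.normSq ((W *ᵥ x) b) = ∑ a, Complex.normSq (x a) := by
  have h : star (W *ᵥ x) ⬝ᵥ (W *ᵥ x) = star x ⬝ᵥ x := by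
    rw [Matrix.star_mulVec, ← Matrix.dotProduct_mulVec, Matrix.mulVec_mulVec, hW,
      Matrix.one_mulVec]
  have h' : ((∑ b, Complex.normSq ((W *ᵥ x) b) : ℝ) : ℂ) =
      ((∑ a, Complex.normSq (x a) : ℝ) : ℂ) := by
    simpa [dotProduct, Complex.normSq_eq_conj_mul_self] using h
  exact_mod_cast h'

theorem sum_normSq_clockVec (e : A → ℝ) (c : A → ℂ) (t : ℝ) :
    ∑ a, Complex.normSq (clockVec e c t a) = ∑ a, Complex.normSq (c a) := by
  refine Finset.sum_congr rfl fun a _ => ?_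
  rw [clockVec, map_mul, Complex.normSq_eq_norm_sq (Complex.exp _), Complex.norm_exp]
  simp

theorem IsCompletelyPositive.trace_ketBra_eq [DecidableEq A] [DecidableEq B]
    {E : Matrix A A ℂ →ₗ[ℂ] Matrix B B ℂ} (hE : IsCompletelyPositive E) :
    ∃ K : A × B → Matrix B A ℂ,
      (∀ v, (E (ketBra v)).trace = ((∑ j, ∑ b, Complex.normSq ((K j *ᵥ v) b) : ℝ) : ℂ)) ∧
      ∀ u v, (ketBra u * E (ketBra v)).trace =
        ((∑ j, Complex.normSq (star u ⬝ᵥ (K j *ᵥ v)) : ℝ) : ℂ) := by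
  obtain ⟨K, hK⟩ := hE.exists_kraus
  refine ⟨K, fun v => ?_, fun u v => ?_⟩
  · rw [hK, Matrix.trace_sum]
    simp_rw [trace_conj_ketBra]
    push_cast
    rfl
  · rw [hK, Finset.mul_sum, Matrix.trace_sum]
    simp_rw [trace_ketBra_mul_conj]
    push_cast
    rfl

end Isometry

/-! ### The optimal fidelity and its behaviour under division -/

section Optimum

variable {d : Type*} [Fintype d] [DecidableEq d] {H : Matrix d d ℂ} {ψ : d → ℂ}
  {U : Matrix d d ℂ} {e : d → ℝ} {c : d → ℂ}

theorem copies_eq (hstate : ∀ t, clockState H ψ t = U *ᵥ clockVec e c t) (P : Type*) [Fintype P]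
    [DecidableEq P] (t : ℝ) : copies H ψ P t =
      ketBra (powerMatrix P U *ᵥ clockVec (totalEnergy e) (totalAmplitude c) t) := by
  rw [copies, hstate, tensorPower_mulVec_clockVec]

/-- The probability that the total energy of `m` particles differs by `μ` from a value that the
total energy of `n` particles can take. -/
noncomputable def cloneOverlap (e : d → ℝ) (c : d → ℂ) (n m : ℕ) (μ : ℝ) : ℝ :=
  spectralOverlap (totalEnergy e : (Fin n → d) → ℝ) (totalAmplitude c)
    (totalEnergy e : (Fin m → d) → ℝ) (totalAmplitude c) μ

theorem ProbCloner.trace_im_eq_zero {n m : ℕ} (C : ProbCloner H ψ n m) (t : ℝ) :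
    (C.op (copies H ψ (Fin n) t)).trace.im = 0 := by
  obtain ⟨K, h1, -⟩ := C.completelyPositive.trace_ketBra_eq
  rw [copies, h1, Complex.ofReal_im]

theorem ProbCloner.trace_copies_mul_im_eq_zero {n m : ℕ} (C : ProbCloner H ψ n m) (t : ℝ) :
    (copies H ψ (Fin m) t * C.op (copies H ψ (Fin n) t)).trace.im = 0 := by
  obtain ⟨K, -, h2⟩ := C.completelyPositive.trace_ketBra_eq
  rw [copies, copies, h2, Complex.ofReal_im]

theorem ProbCloner.fidelityAt_nonneg {n m : ℕ} (C : ProbCloner H ψ n m) (t : ℝ) :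
    0 ≤ fidelityAt H ψ C.op t := by
  refine div_nonneg ?_ (C.successProb_pos t).le
  obtain ⟨K, -, h2⟩ := C.completelyPositive.trace_ketBra_eq
  rw [copies, copies, h2, Complex.ofReal_re]
  exact Finset.sum_nonneg fun _ _ => Complex.normSq_nonneg _

theorem ProbCloner.fidelityAt_le_one (hU : Uᴴ * U = 1)
    (hstate : ∀ t, clockState H ψ t = U *ᵥ clockVec e c t)
    (hc : ∑ x, Complex.normSq (c x) = 1) {n m : ℕ} (C : ProbCloner H ψ n m) (t : ℝ) :
    fidelityAt H ψ C.op t ≤ 1 := by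
  have hpos := C.successProb_pos t
  rw [fidelityAt, div_le_one hpos]
  obtain ⟨K, h1, h2⟩ := C.completelyPositive.trace_ketBra_eq
  rw [successProb, copies_eq hstate, copies_eq hstate, h1, h2, Complex.ofReal_re, Complex.ofReal_re]
  refine Finset.sum_le_sum fun j _ => ?_
  refine (normSq_sum_mul_le _ _ _).trans_eq ?_
  simp only [Pi.star_apply, RCLike.star_def, Complex.normSq_conj]
  rw [sum_normSq_mulVec (powerMatrix_conjTranspose_mul_self _ hU), sum_normSq_clockVec,
    sum_normSq_totalAmplitude _ hc, one_mul]

theorem ProbCloner.bddBelow {n m : ℕ} (C : ProbCloner H ψ n m) :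
    BddBelow (Set.range fun t => fidelityAt H ψ C.op t) :=
  ⟨0, by rintro _ ⟨t, rfl⟩; exact C.fidelityAt_nonneg t⟩

/-- Conjugating the Kraus operators by the tensor powers of `U` moves the problem to the energy
basis without changing probabilities or overlaps. -/
theorem ProbCloner.fidelity_le (hU : Uᴴ * U = 1)
    (hstate : ∀ t, clockState H ψ t = U *ᵥ clockVec e c t) {n m : ℕ}
    (C : ProbCloner H ψ n m) {F : ℝ} (hF : ∀ μ, cloneOverlap e c n m μ ≤ F) :
    fidelity H ψ C.op ≤ F := by
  obtain ⟨K, h1, h2⟩ := C.completelyPositive.trace_ketBra_eq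
  have hW := powerMatrix_conjTranspose_mul_self (Fin m) hU
  have hW' := mul_eq_one_comm.1 hW
  have e1 : ∀ t, successProb H ψ C.op t = ∑ j, ∑ b, Complex.normSq
      ((((powerMatrix (Fin m) U)ᴴ * K j * powerMatrix (Fin n) U) *ᵥ
        clockVec (totalEnergy e) (totalAmplitude c) t) b) := by
    intro t
    rw [successProb, copies_eq hstate, h1, Complex.ofReal_re]
    refine Finset.sum_congr rfl fun j _ => ?_
    rw [Matrix.mul_assoc, ← Matrix.mulVec_mulVec, sum_normSq_mulVec
      (W := (powerMatrix (Fin m) U)ᴴ) (by rw [Matrix.conjTranspose_conjTranspose, hW']),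
      Matrix.mulVec_mulVec]
  have e2 : ∀ t, (copies H ψ (Fin m) t * C.op (copies H ψ (Fin n) t)).trace.re =
      ∑ j, Complex.normSq (star (clockVec (totalEnergy e) (totalAmplitude c) t) ⬝ᵥ
        (((powerMatrix (Fin m) U)ᴴ * K j * powerMatrix (Fin n) U) *ᵥ
        clockVec (totalEnergy e) (totalAmplitude c) t)) := by
    intro t
    rw [copies_eq hstate, copies_eq hstate, h2, Complex.ofReal_re]
    refine Finset.sum_congr rfl fun j _ => ?_
    rw [Matrix.star_mulVec, ← Matrix.dotProduct_mulVec, Matrix.mulVec_mulVec, Matrix.mulVec_mulVec,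
      Matrix.mul_assoc]
  refine le_of_forall_kraus_fidelity _ _ _ _
    (fun j => (powerMatrix (Fin m) U)ᴴ * K j * powerMatrix (Fin n) U) F _ hF (fun t => ?_) 0 ?_
  · rw [← e1, ← e2]
    have := ciInf_le C.bddBelow t
    rwa [fidelityAt, le_div_iff₀ (C.successProb_pos t)] at this
  · rw [← e1]
    exact C.successProb_pos 0

/-- The filter that shifts the energy of a clock state by `μ` and turns the amplitudes `cA` into
the amplitudes `cB`. -/
noncomputable def shiftFilter {A B : Type*} [Fintype A] (eA : A → ℝ) (cA : A → ℂ) (eB : B → ℝ)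
    (cB : B → ℂ) (μ : ℝ) : Matrix B A ℂ :=
  open Classical in
  Matrix.of fun b a => if eB b = eA a + μ then
    cB b * star (cA a) / ((∑ a' with eA a' = eA a, Complex.normSq (cA a') : ℝ) : ℂ) else 0

/-- The denominator is the weight of a whole, possibly degenerate, input level and cancels the sum
over that level. What remains is the perfect target restricted to the shifted spectrum, up to a
global phase. -/
theorem shiftFilter_mulVec {A B : Type*} [Fintype A] (eA : A → ℝ) (cA : A → ℂ) (eB : B → ℝ)
    (cB : B → ℂ) (μ t : ℝ) (b : B) [Decidable (∃ a, cA a ≠ 0 ∧ eB b = eA a + μ)] :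
    (shiftFilter eA cA eB cB μ *ᵥ clockVec eA cA t) b =
      if ∃ a, cA a ≠ 0 ∧ eB b = eA a + μ then
        clockVec eB cB t b * Complex.exp ((μ * Complex.I) * t) else 0 := by
  classical
  simp only [Matrix.mulVec, dotProduct, shiftFilter, Matrix.of_apply, ite_mul, zero_mul]
  split_ifs with h
  · obtain ⟨a₀, h0, h1⟩ := h
    set s : ℝ := ∑ a' with eA a' = eA a₀, Complex.normSq (cA a') with hs
    have hs0 : (s : ℂ) ≠ 0 := by
      have : 0 < s := Finset.sum_pos' (fun _ _ => Complex.normSq_nonneg _)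
        ⟨a₀, by simp, Complex.normSq_pos.2 h0⟩
      exact_mod_cast this.ne'
    have : ∀ a, (if eB b = eA a + μ then cB b * star (cA a) /
        ((∑ a' with eA a' = eA a, Complex.normSq (cA a') : ℝ) : ℂ) * clockVec eA cA t a else 0) =
        (clockVec eB cB t b * Complex.exp ((μ * Complex.I) * t) / s) *
          ((if eA a = eA a₀ then Complex.normSq (cA a) else 0 : ℝ) : ℂ) := by
      intro a
      by_cases ha : eA a = eA a₀
      · rw [if_pos (by rw [h1, ha]), if_pos ha, ha, ← hs, clockVec, clockVec, ha, h1,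
          Complex.normSq_eq_conj_mul_self]
        have : Complex.exp ((-eA a₀ * Complex.I) * t) =
            Complex.exp (-((eA a₀ + μ : ℝ) : ℂ) * Complex.I * t) *
              Complex.exp ((μ * Complex.I) * t) := by
          rw [← Complex.exp_add]
          congr 1
          push_cast
          ring
        rw [this, RCLike.star_def]
        ring
      · rw [if_neg (fun h => ha (by linarith)), if_neg ha]
        simp
    rw [Finset.sum_congr rfl fun a _ => this a, ← Finset.mul_sum, ← Complex.ofReal_sum,
      ← Finset.sum_filter, ← hs, div_mul_cancel₀ _ hs0]
  · refine Finset.sum_eq_zero fun a _ => ?_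
    split_ifs with h'
    · have : cA a = 0 := by
        by_contra h0
        exact h ⟨a, h0, h'⟩
      simp [this]
    · rfl

/-- The truncated target has squared norm `P` and squared overlap `P ^ 2` with the full target, so
the conditional fidelity is `P` at every time; the scale `r` cancels. -/
theorem exists_probCloner_fidelity_eq (hU : Uᴴ * U = 1)
    (hstate : ∀ t, clockState H ψ t = U *ᵥ clockVec e c t) {n m : ℕ} {μ : ℝ}
    (hμ : 0 < cloneOverlap e c n m μ) :
    ∃ C : ProbCloner H ψ n m, fidelity H ψ C.op = cloneOverlap e c n m μ := by
  classical
  set eA : (Fin n → d) → ℝ := totalEnergy e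
  set eB : (Fin m → d) → ℝ := totalEnergy e
  set cA : (Fin n → d) → ℂ := totalAmplitude c
  set cB : (Fin m → d) → ℂ := totalAmplitude c
  set W := powerMatrix (Fin m) U
  set V := powerMatrix (Fin n) U
  have hW : Wᴴ * W = 1 := powerMatrix_conjTranspose_mul_self _ hU
  have hV : Vᴴ * V = 1 := powerMatrix_conjTranspose_mul_self _ hU
  set S := shiftFilter eA cA eB cB μ with hS
  set P := cloneOverlap e c n m μ with hP
  obtain ⟨r, hr, hle⟩ := exists_trace_conj_le (W * S * Vᴴ)
  set K : Matrix (Fin m → d) (Fin n → d) ℂ := ((Real.sqrt r : ℝ) : ℂ) • (W * S * Vᴴ) with hK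
  have hconj : ∀ X, conjMap K X = (r : ℂ) • ((W * S * Vᴴ) * X * (W * S * Vᴴ)ᴴ) := by
    intro X
    rw [conjMap_apply, hK, Matrix.conjTranspose_smul, Matrix.smul_mul, Matrix.smul_mul,
      Matrix.mul_smul, smul_smul]
    congr 1
    rw [RCLike.star_def, Complex.conj_ofReal, ← Complex.ofReal_mul, Real.mul_self_sqrt hr.le]
  have hnormexp : ∀ t : ℝ, Complex.normSq (Complex.exp ((μ * Complex.I) * t)) = 1 := by
    intro t
    rw [Complex.normSq_eq_norm_sq, Complex.norm_exp]
    simp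
  have hvec : ∀ t, (W * S * Vᴴ) *ᵥ (V *ᵥ clockVec eA cA t) = W *ᵥ (S *ᵥ clockVec eA cA t) := by
    intro t
    rw [Matrix.mulVec_mulVec, Matrix.mul_assoc, hV, Matrix.mul_one, Matrix.mulVec_mulVec]
  have hprob : ∀ t, successProb H ψ (conjMap K) t = r * P := by
    intro t
    rw [successProb, hconj, Matrix.trace_smul, copies_eq hstate, trace_conj_ketBra, hvec,
      sum_normSq_mulVec hW, smul_eq_mul, Complex.re_ofReal_mul, Complex.ofReal_re]
    congr 1
    rw [hP, cloneOverlap, spectralOverlap, Finset.sum_filter]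
    refine Finset.sum_congr rfl fun b _ => ?_
    rw [hS, shiftFilter_mulVec]
    split_ifs
    · rw [map_mul, hnormexp, mul_one, clockVec, map_mul, Complex.normSq_eq_norm_sq (Complex.exp _),
        Complex.norm_exp]
      simp [cB]
    · simp
  have hfid : ∀ t, fidelityAt H ψ (conjMap K) t = P := by
    intro t
    rw [fidelityAt, hprob, hconj, Matrix.mul_smul, Matrix.trace_smul, copies_eq hstate,
      copies_eq hstate, trace_ketBra_mul_conj, hvec, smul_eq_mul, Complex.re_ofReal_mul,
      Complex.ofReal_re, Matrix.star_mulVec, ← Matrix.dotProduct_mulVec, Matrix.mulVec_mulVec, hW,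
      Matrix.one_mulVec]
    have : star (clockVec eB cB t) ⬝ᵥ (S *ᵥ clockVec eA cA t) =
        (P : ℂ) * Complex.exp ((μ * Complex.I) * t) := by
      rw [hP, cloneOverlap, spectralOverlap, Finset.sum_filter, Complex.ofReal_sum, Finset.sum_mul]
      refine Finset.sum_congr rfl fun b _ => ?_
      rw [hS, shiftFilter_mulVec]
      split_ifs
      · rw [← mul_assoc]
        congr 1
        rw [Pi.star_apply, RCLike.star_def, ← Complex.normSq_eq_conj_mul_self, clockVec, map_mul,
          Complex.normSq_eq_norm_sq (Complex.exp _), Complex.norm_exp]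
        simp [cB]
      · simp
    rw [this, map_mul, hnormexp, mul_one, Complex.normSq_ofReal]
    field_simp
  refine ⟨⟨conjMap K, isCompletelyPositive_conjMap K, fun X hX => ?_, fun t => ?_⟩, ?_⟩
  · rw [hconj, Matrix.trace_smul, smul_eq_mul, Complex.re_ofReal_mul]
    exact hle X hX
  · rw [hprob]
    positivity
  · simp only [fidelity, hfid, ciInf_const]

omit [DecidableEq d] in
theorem exists_max_cloneOverlap (hc : ∑ x, Complex.normSq (c x) = 1) (n m : ℕ) :
    ∃ μ₀, 0 < cloneOverlap e c n m μ₀ ∧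
      ∀ μ, cloneOverlap e c n m μ ≤ cloneOverlap e c n m μ₀ := by
  classical
  obtain ⟨μ₀, h⟩ := exists_max_spectralOverlap (totalEnergy e : (Fin n → d) → ℝ)
    (totalAmplitude c) (totalEnergy e : (Fin m → d) → ℝ) (totalAmplitude c)
  refine ⟨μ₀, ?_, h⟩
  obtain ⟨x, hx⟩ : ∃ x, c x ≠ 0 := by
    by_contra h
    push Not at h
    simp [h] at hc
  have h0 : ∀ k, totalAmplitude c (fun _ : Fin k => x) ≠ 0 :=
    fun k => Finset.prod_ne_zero_iff.2 fun _ _ => hx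
  -- This shift aligns the configurations with every particle in state `x`, so its overlap is
  -- positive.
  refine lt_of_lt_of_le ?_ (h (totalEnergy e (fun _ : Fin m => x) -
    totalEnergy e (fun _ : Fin n => x)))
  refine Finset.sum_pos' (fun _ _ => Complex.normSq_nonneg _) ⟨fun _ => x, ?_,
    Complex.normSq_pos.2 (h0 m)⟩
  exact Finset.mem_filter.2 ⟨Finset.mem_univ _, fun _ => x, h0 n, by ring⟩

theorem exists_isOptimal (hU : Uᴴ * U = 1)
    (hstate : ∀ t, clockState H ψ t = U *ᵥ clockVec e c t)
    (hc : ∑ x, Complex.normSq (c x) = 1) (n m : ℕ) :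
    ∃ C : ProbCloner H ψ n m, C.IsOptimal := by
  obtain ⟨μ₀, hpos, hmax⟩ := exists_max_cloneOverlap (e := e) hc n m
  obtain ⟨C, hC⟩ := exists_probCloner_fidelity_eq hU hstate hpos
  exact ⟨C, fun C' => (C'.fidelity_le hU hstate hmax).trans_eq hC.symm⟩

/-- The comparison passes through the best shift, since the construction of a cloner needs a
positive overlap. -/
theorem ProbCloner.IsOptimal.cloneOverlap_le_fidelity (hU : Uᴴ * U = 1)
    (hstate : ∀ t, clockState H ψ t = U *ᵥ clockVec e c t)
    (hc : ∑ x, Complex.normSq (c x) = 1) {n m : ℕ} {C : ProbCloner H ψ n m} (hC : C.IsOptimal)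
    (μ : ℝ) : cloneOverlap e c n m μ ≤ fidelity H ψ C.op := by
  obtain ⟨μ₀, hpos, hmax⟩ := exists_max_cloneOverlap (e := e) hc n m
  obtain ⟨C', hC'⟩ := exists_probCloner_fidelity_eq hU hstate hpos
  exact (hmax μ).trans (hC'.symm.trans_le (hC C'))

variable {N M : ℕ} (D : Division N M) (C : ∀ i, ProbCloner H ψ (D.inSize i) (D.outSize i))

theorem fidelityAt_divideAndClone (t : ℝ) :
    fidelityAt H ψ (tensorMap fun i => (C i).op) t = ∏ i, fidelityAt H ψ (C i).op t :=
  fidelityAt_tensorMap H ψ _ t (fun i => (C i).trace_im_eq_zero t)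
    (fun i => (C i).trace_copies_mul_im_eq_zero t)

theorem bddBelow_fidelityAt_divideAndClone :
    BddBelow (Set.range fun t => fidelityAt H ψ (tensorMap fun i => (C i).op) t) := by
  refine ⟨0, ?_⟩
  rintro _ ⟨t, rfl⟩
  simp only [fidelityAt_divideAndClone]
  exact Finset.prod_nonneg fun i _ => (C i).fidelityAt_nonneg t

theorem divideAndCloneFidelity_le_one (hU : Uᴴ * U = 1)
    (hstate : ∀ t, clockState H ψ t = U *ᵥ clockVec e c t)
    (hc : ∑ x, Complex.normSq (c x) = 1) : divideAndCloneFidelity D C ≤ 1 := by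
  refine (ciInf_le (bddBelow_fidelityAt_divideAndClone D C) 0).trans ?_
  rw [fidelityAt_divideAndClone]
  exact Finset.prod_le_one (fun i _ => (C i).fidelityAt_nonneg 0)
    fun i _ => (C i).fidelityAt_le_one hU hstate hc 0

/-- All other factors are at most `1`, so one poor group limits the whole strategy. -/
theorem divideAndCloneFidelity_le (hU : Uᴴ * U = 1)
    (hstate : ∀ t, clockState H ψ t = U *ᵥ clockVec e c t)
    (hc : ∑ x, Complex.normSq (c x) = 1) (i : Fin D.groups) :
    divideAndCloneFidelity D C ≤ fidelity H ψ (C i).op := by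
  refine ciInf_mono (bddBelow_fidelityAt_divideAndClone D C) fun t => ?_
  rw [fidelityAt_divideAndClone, ← Finset.mul_prod_erase _ _ (Finset.mem_univ i)]
  exact mul_le_of_le_one_right ((C i).fidelityAt_nonneg t) (Finset.prod_le_one
    (fun i _ => (C i).fidelityAt_nonneg t) fun i _ => (C i).fidelityAt_le_one hU hstate hc t)

theorem prod_le_divideAndCloneFidelity (F : Fin D.groups → ℝ) (hF0 : ∀ i, 0 ≤ F i)
    (hF : ∀ i, F i ≤ fidelity H ψ (C i).op) : ∏ i, F i ≤ divideAndCloneFidelity D C := by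
  refine le_ciInf fun t => ?_
  rw [fidelityAt_divideAndClone]
  exact Finset.prod_le_prod (fun i _ => hF0 i) fun i _ =>
    (hF i).trans (ciInf_le (C i).bddBelow t)

end Optimum

/-! ### Sums of independent energies -/

section Deviation

variable {ι : Type*} [Fintype ι] {w : ι → ℝ} {f : ι → ℝ}

/-- The linear term averages out for a centred variable, leaving a sub-Gaussian bound on the moment
generating function. -/
theorem exp_le_add_exp_sq (x : ℝ) : Real.exp x ≤ x + Real.exp (x ^ 2) := by
  have h1 := Real.add_one_le_exp (x ^ 2)
  rcases le_or_gt (|x|) 1 with h | h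
  · have h2 := Real.abs_exp_sub_one_sub_id_le h
    have h3 := (abs_le.1 h2).2
    linarith
  · rcases lt_or_ge x 0 with h0 | h0
    · rw [abs_of_neg h0] at h
      have : Real.exp x ≤ 1 := Real.exp_le_one_iff.2 h0.le
      nlinarith
    · rw [abs_of_nonneg h0] at h
      have : Real.exp x ≤ Real.exp (x ^ 2) := Real.exp_le_exp.2 (by nlinarith)
      linarith

theorem sum_prod_eq_one (hw1 : ∑ x, w x = 1) (m : ℕ) : ∑ a : Fin m → ι, ∏ j, w (a j) = 1 := by
  rw [← Fintype.prod_sum fun (_ : Fin m) x => w x]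
  simp [hw1]

theorem sum_filter_prod_le_exp (hw : ∀ x, 0 ≤ w x) (hw1 : ∑ x, w x = 1)
    (hf0 : ∑ x, w x * f x = 0) (hf1 : ∀ x, |f x| ≤ 1) (m : ℕ) {u : ℝ} (hu : 0 ≤ u) :
    ∑ a : Fin m → ι with u ≤ ∑ j, f (a j), ∏ j, w (a j) ≤ Real.exp (-(u ^ 2 / (4 * m))) := by
  classical
  -- Chernoff parameter minimising `m * l ^ 2 - l * u`. For `m = 0` division by zero makes `l = 0`
  -- and the bound `1`.
  set l : ℝ := u / (2 * m) with hl
  have hl0 : 0 ≤ l := by positivity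
  have hmgf : ∑ x, w x * Real.exp (l * f x) ≤ Real.exp (l ^ 2) := by
    calc ∑ x, w x * Real.exp (l * f x) ≤ ∑ x, (l * (w x * f x) + w x * Real.exp (l ^ 2)) := by
          refine Finset.sum_le_sum fun x _ => ?_
          have h1 := exp_le_add_exp_sq (l * f x)
          have h2 : Real.exp ((l * f x) ^ 2) ≤ Real.exp (l ^ 2) := by
            refine Real.exp_le_exp.2 ?_
            rw [mul_pow]
            have : f x ^ 2 ≤ 1 := (sq_le_one_iff_abs_le_one _).2 (hf1 x)
            nlinarith [sq_nonneg l]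
          have := mul_le_mul_of_nonneg_left (h1.trans (by gcongr : _ ≤ l * f x + Real.exp (l ^ 2)))
            (hw x)
          linarith
      _ = Real.exp (l ^ 2) := by
          rw [Finset.sum_add_distrib, ← Finset.mul_sum, hf0, ← Finset.sum_mul, hw1]
          ring
  calc ∑ a : Fin m → ι with u ≤ ∑ j, f (a j), ∏ j, w (a j)
      ≤ ∑ a : Fin m → ι with u ≤ ∑ j, f (a j),
          Real.exp (-(l * u)) * ∏ j, (w (a j) * Real.exp (l * f (a j))) := by
        refine Finset.sum_le_sum fun a ha => ?_
        have ha := (Finset.mem_filter.1 ha).2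
        rw [Finset.prod_mul_distrib, ← Real.exp_sum, mul_left_comm, ← Real.exp_add,
          ← Finset.mul_sum]
        refine le_mul_of_one_le_right (Finset.prod_nonneg fun j _ => hw _) (Real.one_le_exp ?_)
        nlinarith
    _ ≤ ∑ a : Fin m → ι, Real.exp (-(l * u)) * ∏ j, (w (a j) * Real.exp (l * f (a j))) :=
        Finset.sum_le_sum_of_subset_of_nonneg (Finset.filter_subset _ _) fun a _ _ =>
          mul_nonneg (Real.exp_nonneg _) (Finset.prod_nonneg fun j _ =>
            mul_nonneg (hw _) (Real.exp_nonneg _))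
    _ = Real.exp (-(l * u)) * (∑ x, w x * Real.exp (l * f x)) ^ m := by
        rw [← Finset.mul_sum, ← Fintype.prod_sum fun (_ : Fin m) x => w x * Real.exp (l * f x)]
        simp
    _ ≤ Real.exp (-(l * u)) * Real.exp (l ^ 2) ^ m := by
        gcongr
        exact Finset.sum_nonneg fun x _ => mul_nonneg (hw x) (Real.exp_nonneg _)
    _ = Real.exp (-(u ^ 2 / (4 * m))) := by
        rw [← Real.exp_nat_mul, ← Real.exp_add]
        congr 1
        rcases Nat.eq_zero_or_pos m with rfl | hm
        · simp [hl]
        · have : (m : ℝ) ≠ 0 := by positivity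
          rw [hl]
          field_simp
          ring

/-- Change of measure: tilting `w` by `1 + θ f` with `θ` of order `1 / √m` makes the deviation
typical, while the second moment of the likelihood ratio stays bounded in `m`. Cauchy–Schwarz
transfers the lower bound back to `w`. -/
theorem exists_le_sum_filter_prod (hw : ∀ x, 0 ≤ w x) (hw1 : ∑ x, w x = 1)
    (hf0 : ∑ x, w x * f x = 0) (hf2 : 0 < ∑ x, w x * f x ^ 2) (D : ℝ) :
    ∃ η : ℝ, 0 < η ∧ ∃ m₀ : ℕ, ∀ m : ℕ, m₀ ≤ m →
      η ≤ ∑ a : Fin m → ι with D * √m ≤ ∑ j, f (a j), ∏ j, w (a j) := by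
  classical
  set v := ∑ x, w x * f x ^ 2 with hv
  obtain ⟨B, hB0, hB⟩ : ∃ B : ℝ, 0 < B ∧ ∀ x, |f x| ≤ B := by
    refine ⟨∑ x, |f x| + 1, by positivity, fun x => ?_⟩
    have := Finset.single_le_sum (f := fun x => |f x|) (fun x _ => abs_nonneg _)
      (Finset.mem_univ x)
    linarith
  have hvB : v ≤ B ^ 2 := by
    calc v ≤ ∑ x, w x * B ^ 2 := by
          refine Finset.sum_le_sum fun x _ => mul_le_mul_of_nonneg_left ?_ (hw x)
          exact sq_le_sq' (abs_le.1 (hB x)).1 (abs_le.1 (hB x)).2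
      _ = B ^ 2 := by rw [← Finset.sum_mul, hw1, one_mul]
  -- With `θ = τ / √m` the tilted mean of the sum is `(4 * B + |D|) * √m`, which exceeds the
  -- threshold by at least `4 * B * √m`.
  set τ : ℝ := (4 * B + |D|) / v with hτ
  have hτ0 : 0 < τ := by positivity
  have hτv : τ * v = 4 * B + |D| := by rw [hτ]; field_simp
  -- This makes `θ * B ≤ 1`, so that the tilted weights are nonnegative.
  obtain ⟨m₀, hm₀⟩ := exists_nat_ge ((τ * B) ^ 2)
  refine ⟨Real.exp (-(τ ^ 2 * v)) / 4, by positivity, m₀ + 1, fun m hm => ?_⟩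
  have hmpos : (0 : ℝ) < m := by exact_mod_cast (by omega : 0 < m)
  have hs : 0 < √(m : ℝ) := Real.sqrt_pos.2 hmpos
  have hss : √(m : ℝ) * √m = m := Real.mul_self_sqrt hmpos.le
  set θ : ℝ := τ / √m with hθ
  have hθ0 : 0 < θ := by positivity
  have hθs : θ * √m = τ := by rw [hθ]; field_simp
  have hθB : θ * B ≤ 1 := by
    rw [hθ, div_mul_eq_mul_div, div_le_one hs]
    refine Real.le_sqrt_of_sq_le (hm₀.trans ?_)
    exact_mod_cast (by omega : m₀ ≤ m)
  have hθf : ∀ x, |θ * f x| ≤ 1 := fun x => by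
    rw [abs_mul, abs_of_pos hθ0]
    exact (mul_le_mul_of_nonneg_left (hB x) hθ0.le).trans hθB
  set q : ι → ℝ := fun x => w x * (1 + θ * f x) with hq
  have hq0 : ∀ x, 0 ≤ q x := fun x => mul_nonneg (hw x) (by linarith [(abs_le.1 (hθf x)).1])
  have hq1 : ∑ x, q x = 1 := by
    have : ∀ x, q x = w x + θ * (w x * f x) := fun x => by rw [hq]; ring
    simp_rw [this]
    rw [Finset.sum_add_distrib, ← Finset.mul_sum, hf0, hw1]
    ring
  have hqf : ∑ x, q x * f x = θ * v := by
    have : ∀ x, q x * f x = w x * f x + θ * (w x * f x ^ 2) := fun x => by rw [hq]; ring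
    simp_rw [this]
    rw [Finset.sum_add_distrib, ← Finset.mul_sum, hf0]
    ring
  -- Centred and scaled to `|g| ≤ 1`. Missing the threshold forces the sum of `g` above `2 * √m`,
  -- which has probability at most `exp (-1) ≤ 1 / 2`.
  set g : ι → ℝ := fun x => (θ * v - f x) / (2 * B) with hg
  have hqg : ∑ x, q x * g x = 0 := by
    have : ∀ x, q x * g x = (θ * v * q x - q x * f x) / (2 * B) := fun x => by rw [hg]; ring
    simp_rw [this]
    rw [← Finset.sum_div, Finset.sum_sub_distrib, ← Finset.mul_sum, hq1, hqf]
    simp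
  have hg1 : ∀ x, |g x| ≤ 1 := fun x => by
    rw [hg]
    simp only
    rw [abs_div, abs_of_pos (by positivity : (0 : ℝ) < 2 * B), div_le_one (by positivity)]
    have h1 : θ * v ≤ B := by nlinarith
    have h2 : 0 ≤ θ * v := by positivity
    have h3 := abs_le.1 (hB x)
    rw [abs_le]
    constructor <;> linarith
  have hch := sum_filter_prod_le_exp hq0 hq1 hqg hg1 m (u := 2 * √m) (by positivity)
  have hexp : Real.exp (-((2 * √(m : ℝ)) ^ 2 / (4 * m))) ≤ 1 / 2 := by
    have : (2 * √(m : ℝ)) ^ 2 / (4 * m) = 1 := by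
      rw [mul_pow, Real.sq_sqrt hmpos.le]
      field_simp
      norm_num
    rw [this, Real.exp_neg, one_div]
    exact inv_anti₀ (by norm_num) (by linarith [Real.add_one_le_exp (1 : ℝ)])
  set T : Finset (Fin m → ι) := {a | D * √m ≤ ∑ j, f (a j)} with hT
  have hQ : 1 / 2 ≤ ∑ a ∈ T, ∏ j, q (a j) := by
    have hall := sum_prod_eq_one hq1 m
    rw [← Finset.sum_filter_add_sum_filter_not Finset.univ
      (fun a : Fin m → ι => D * √m ≤ ∑ j, f (a j))] at hall
    have hsub : ∑ a : Fin m → ι with ¬ D * √m ≤ ∑ j, f (a j), ∏ j, q (a j) ≤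
        ∑ a : Fin m → ι with 2 * √m ≤ ∑ j, g (a j), ∏ j, q (a j) := by
      refine Finset.sum_le_sum_of_subset_of_nonneg ?_ fun a _ _ =>
        Finset.prod_nonneg fun j _ => hq0 _
      intro a ha
      have ha := not_le.1 (Finset.mem_filter.1 ha).2
      refine Finset.mem_filter.2 ⟨Finset.mem_univ _, ?_⟩
      rw [hg, ← Finset.sum_div, le_div_iff₀ (by positivity), Finset.sum_sub_distrib]
      simp only [Finset.sum_const, Finset.card_univ, Fintype.card_fin, nsmul_eq_mul]
      have h1 : (m : ℝ) * (θ * v) = (4 * B + |D|) * √m := by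
        calc (m : ℝ) * (θ * v) = √m * √m * (θ * v) := by rw [hss]
          _ = θ * √m * v * √m := by ring
          _ = (4 * B + |D|) * √m := by rw [hθs, hτv]
      rw [h1]
      nlinarith [mul_le_mul_of_nonneg_right (le_abs_self D) hs.le]
    linarith
  have hCS : (∑ a ∈ T, ∏ j, q (a j)) ^ 2 ≤
      (∑ a ∈ T, ∏ j, w (a j)) * Real.exp (τ ^ 2 * v) := by
    have h1 : ∀ a : Fin m → ι, ∏ j, q (a j) =
        √(∏ j, w (a j)) * (√(∏ j, w (a j)) * ∏ j, (1 + θ * f (a j))) := fun a => by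
      rw [← mul_assoc, Real.mul_self_sqrt (Finset.prod_nonneg fun j _ => hw _),
        ← Finset.prod_mul_distrib]
    simp_rw [h1]
    refine (Finset.sum_mul_sq_le_sq_mul_sq _ _ _).trans ?_
    have h2 : ∀ a : Fin m → ι, √(∏ j, w (a j)) ^ 2 = ∏ j, w (a j) := fun a =>
      Real.sq_sqrt (Finset.prod_nonneg fun j _ => hw _)
    simp_rw [mul_pow, h2]
    refine mul_le_mul_of_nonneg_left ?_
      (Finset.sum_nonneg fun a _ => Finset.prod_nonneg fun j _ => hw _)
    simp_rw [← Finset.prod_pow, ← Finset.prod_mul_distrib]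
    calc ∑ a ∈ T, ∏ j, (w (a j) * (1 + θ * f (a j)) ^ 2)
        ≤ ∑ a : Fin m → ι, ∏ j, (w (a j) * (1 + θ * f (a j)) ^ 2) :=
          Finset.sum_le_sum_of_subset_of_nonneg (Finset.subset_univ _) fun a _ _ =>
            Finset.prod_nonneg fun j _ => mul_nonneg (hw _) (sq_nonneg _)
      _ = (1 + θ ^ 2 * v) ^ m := by
          rw [← Fintype.prod_sum fun (_ : Fin m) x => w x * (1 + θ * f x) ^ 2]
          have : ∀ x, w x * (1 + θ * f x) ^ 2 =
              w x + 2 * θ * (w x * f x) + θ ^ 2 * (w x * f x ^ 2) := fun x => by ring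
          simp_rw [this]
          rw [Finset.prod_const, Finset.card_univ, Fintype.card_fin, Finset.sum_add_distrib,
            Finset.sum_add_distrib, ← Finset.mul_sum, ← Finset.mul_sum, hf0, hw1]
          ring
      _ ≤ Real.exp (θ ^ 2 * v) ^ m := by
          gcongr
          linarith [Real.add_one_le_exp (θ ^ 2 * v)]
      _ = Real.exp (τ ^ 2 * v) := by
          rw [← Real.exp_nat_mul]
          congr 1
          calc (m : ℝ) * (θ ^ 2 * v) = √m * √m * (θ ^ 2 * v) := by rw [hss]
            _ = (θ * √m) ^ 2 * v := by ring
            _ = τ ^ 2 * v := by rw [hθs]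
  have hP0 : 0 ≤ ∑ a ∈ T, ∏ j, w (a j) :=
    Finset.sum_nonneg fun a _ => Finset.prod_nonneg fun j _ => hw _
  have h4 : (1 / 2 : ℝ) ^ 2 ≤ (∑ a ∈ T, ∏ j, w (a j)) * Real.exp (τ ^ 2 * v) :=
    (by gcongr : (1 / 2 : ℝ) ^ 2 ≤ _).trans hCS
  rw [Real.exp_neg, div_le_iff₀ (by norm_num), inv_le_iff_one_le_mul₀ (Real.exp_pos _)]
  linarith

end Deviation

/-! ### Bounds on the optimal fidelity in terms of `n ^ 2 / m` -/

section Overlap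

variable {d : Type*} [Fintype d] {e : d → ℝ} {c : d → ℂ}

omit [Fintype d] in
theorem normSq_totalAmplitude {m : ℕ} (a : Fin m → d) :
    Complex.normSq (totalAmplitude c a) = ∏ j, Complex.normSq (c (a j)) := by
  simp [totalAmplitude]

/-- Only the extent of the `n`-copy spectrum matters: configurations outside the shifted interval
are lost. -/
theorem cloneOverlap_le_one_sub (hc : ∑ x, Complex.normSq (c x) = 1) {lo hi : ℝ}
    (hlo : ∀ x, c x ≠ 0 → lo ≤ e x) (hhi : ∀ x, c x ≠ 0 → e x ≤ hi) {n m : ℕ} {μ : ℝ}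
    (S : Finset (Fin m → d))
    (hS : ∀ a ∈ S, n * hi + μ < ∑ j, e (a j) ∨ ∑ j, e (a j) < n * lo + μ) :
    cloneOverlap e c n m μ ≤ 1 - ∑ a ∈ S, ∏ j, Complex.normSq (c (a j)) := by
  classical
  have hw : ∀ a : Fin m → d, 0 ≤ ∏ j, Complex.normSq (c (a j)) :=
    fun a => Finset.prod_nonneg fun _ _ => Complex.normSq_nonneg _
  rw [← sum_prod_eq_one hc m, ← Finset.sum_sdiff (Finset.subset_univ S), add_sub_cancel_right,
    cloneOverlap, spectralOverlap]
  simp_rw [normSq_totalAmplitude]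
  refine Finset.sum_le_sum_of_subset_of_nonneg ?_ fun a _ _ => hw a
  intro a ha
  obtain ⟨a', h0, h1⟩ := (Finset.mem_filter.1 ha).2
  refine Finset.mem_sdiff.2 ⟨Finset.mem_univ _, fun haS => ?_⟩
  have h0 := Finset.prod_ne_zero_iff.1 h0
  have hle : ∑ j, e (a' j) ≤ n * hi := by
    simpa using Finset.sum_le_sum fun j (_ : j ∈ Finset.univ) => hhi (a' j) (h0 j (Finset.mem_univ _))
  have hge : n * lo ≤ ∑ j, e (a' j) := by
    simpa using Finset.sum_le_sum fun j (_ : j ∈ Finset.univ) => hlo (a' j) (h0 j (Finset.mem_univ _))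
  simp only [totalEnergy] at h1
  rcases hS a haS with h | h <;> linarith

/-- A cloner that increases the number `n` of copies to `m` of order `n ^ 2` or more has a fidelity
bounded away from `1`. -/
theorem exists_cloneOverlap_le (hc : ∑ x, Complex.normSq (c x) = 1)
    (hne : ∃ x y, c x ≠ 0 ∧ c y ≠ 0 ∧ e x < e y) (R : ℝ) :
    ∃ η : ℝ, 0 < η ∧ ∀ (n m : ℕ) (μ : ℝ), n < m → (n : ℝ) ^ 2 ≤ R * m →
      cloneOverlap e c n m μ ≤ 1 - η := by
  classical
  set w : d → ℝ := fun x => Complex.normSq (c x) with hw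
  have hw0 : ∀ x, 0 ≤ w x := fun x => Complex.normSq_nonneg _
  obtain ⟨x₀, y₀, hx₀, hy₀, hxy⟩ := hne
  obtain ⟨xl, hxl, hlo⟩ := Finset.exists_min_image (Finset.univ.filter fun x => c x ≠ 0) e
    ⟨x₀, by simp [hx₀]⟩
  obtain ⟨xh, hxh, hhi⟩ := Finset.exists_max_image (Finset.univ.filter fun x => c x ≠ 0) e
    ⟨x₀, by simp [hx₀]⟩
  simp only [Finset.mem_filter, Finset.mem_univ, true_and] at hxl hlo hxh hhi
  have hr : e xl < e xh := (hlo x₀ hx₀).trans_lt (hxy.trans_le (hhi y₀ hy₀))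
  set μ₁ := ∑ x, w x * e x with hμ₁
  set f : d → ℝ := fun x => e x - μ₁ with hf
  have hf0 : ∑ x, w x * f x = 0 := by
    simp only [hf, mul_sub, Finset.sum_sub_distrib, ← Finset.sum_mul]
    rw [hc, one_mul, sub_self]
  have hf2 : 0 < ∑ x, w x * f x ^ 2 := by
    refine Finset.sum_pos' (fun x _ => mul_nonneg (hw0 x) (sq_nonneg _)) ?_
    by_cases h : f x₀ = 0
    · refine ⟨y₀, Finset.mem_univ _, mul_pos (Complex.normSq_pos.2 hy₀) (pow_pos ?_ 2)⟩
      simp only [hf] at h ⊢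
      linarith
    · exact ⟨x₀, Finset.mem_univ _, mul_pos (Complex.normSq_pos.2 hx₀) (by positivity)⟩
  -- The shifted interval has width at most `(D - 1) * √m`, too short to reach both tails at
  -- distance `D * √m` from the mean.
  set D := √R * (e xh - e xl) + 1 with hD
  obtain ⟨η₁, hη₁, m₁, h₁⟩ := exists_le_sum_filter_prod hw0 hc hf0 hf2 D
  obtain ⟨η₂, hη₂, m₂, h₂⟩ := exists_le_sum_filter_prod (f := fun x => -f x) hw0 hc
    (by simp [hf0]) (by simpa using hf2) D
  have hD0 : 0 < D := by
    have := mul_nonneg (Real.sqrt_nonneg R) (sub_nonneg.2 hr.le)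
    linarith
  have hwl : 0 < w xl := Complex.normSq_pos.2 hxl
  have hwh : 0 < w xh := Complex.normSq_pos.2 hxh
  have hwle : ∀ x, w x ≤ 1 := fun x => by
    rw [← hc]
    exact Finset.single_le_sum (f := w) (fun x _ => hw0 x) (Finset.mem_univ x)
  refine ⟨min (min η₁ η₂) (min (w xl ^ (max m₁ m₂)) (w xh ^ (max m₁ m₂))), by positivity,
    fun n m μ hnm hR => ?_⟩
  have hnm' : (n : ℝ) < m := by exact_mod_cast hnm
  have key : ∀ (S : Finset (Fin m → d)) (η : ℝ), η ≤ ∑ a ∈ S, ∏ j, w (a j) →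
      (∀ a ∈ S, n * e xh + μ < ∑ j, e (a j) ∨ ∑ j, e (a j) < n * e xl + μ) →
      cloneOverlap e c n m μ ≤ 1 - η := fun S η h1 h2 =>
    (cloneOverlap_le_one_sub hc hlo hhi S h2).trans (sub_le_sub_left h1 _)
  rcases lt_or_ge m (max m₁ m₂) with hm | hm
  -- For small `m` the tails are replaced by the two extreme configurations: as `n < m`, the
  -- interval misses one of them.
  · have hpow : ∀ x, w x ^ (max m₁ m₂) ≤
        ∑ a ∈ {(fun _ => x : Fin m → d)}, ∏ j, w (a j) := fun x => by
      simpa using pow_le_pow_of_le_one (hw0 x) (hwle x) hm.le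
    rcases lt_or_ge (n * e xh + μ) (m * e xh) with h | h
    · refine (key {fun _ => xh} _ (hpow xh) fun a ha => Or.inl ?_).trans ?_
      · rw [Finset.mem_singleton.1 ha]
        simpa using h
      · exact sub_le_sub_left ((min_le_right _ _).trans (min_le_right _ _)) _
    · refine (key {fun _ => xl} _ (hpow xl) fun a ha => Or.inr ?_).trans ?_
      · rw [Finset.mem_singleton.1 ha]
        have : (m : ℝ) * e xl < n * e xl + μ := by nlinarith
        simpa using this
      · exact sub_le_sub_left ((min_le_right _ _).trans (min_le_left _ _)) _
  · have hs : 0 < √(m : ℝ) := Real.sqrt_pos.2 ((Nat.cast_nonneg n).trans_lt hnm')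
    have hsum : ∀ a : Fin m → d, ∑ j, f (a j) = ∑ j, e (a j) - m * μ₁ := fun a => by
      simp [hf, Finset.sum_sub_distrib]
    rcases lt_or_ge (n * e xh + μ) (m * μ₁ + D * √m) with h | h
    · refine (key _ _ (h₁ m ((le_max_left _ _).trans hm)) fun a ha => Or.inl ?_).trans ?_
      · have := (Finset.mem_filter.1 ha).2
        rw [hsum] at this
        linarith
      · exact sub_le_sub_left ((min_le_left _ _).trans (min_le_left _ _)) _
    · refine (key _ _ (h₂ m ((le_max_right _ _).trans hm)) fun a ha => Or.inr ?_).trans ?_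
      · have h3 := (Finset.mem_filter.1 ha).2
        rw [Finset.sum_neg_distrib, hsum] at h3
        have h4 : (n : ℝ) ≤ √R * √m := by
          rw [← Real.sqrt_mul' R (Nat.cast_nonneg m)]
          exact Real.le_sqrt_of_sq_le hR
        have h5 : (n : ℝ) * (e xh - e xl) ≤ √R * √m * (e xh - e xl) :=
          mul_le_mul_of_nonneg_right h4 (sub_nonneg.2 hr.le)
        have h6 : D * √m = √R * √m * (e xh - e xl) + √m := by rw [hD]; ring
        nlinarith [mul_pos hD0 hs]
      · exact sub_le_sub_left ((min_le_left _ _).trans (min_le_right _ _)) _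

/-- The energy depends only on occupation numbers, so a bijection of `Fin n` with `Σ x, Fin (k x)`
gives the configuration. -/
theorem exists_card_fiber_eq [DecidableEq d] (k : d → ℕ) {n : ℕ} (hk : ∑ x, k x = n) :
    ∃ a : Fin n → d, (∀ j, k (a j) ≠ 0) ∧ ∑ j, e (a j) = ∑ x, k x * e x := by
  have hcard : Fintype.card (Fin n) = Fintype.card (Σ x, Fin (k x)) := by simp [hk]
  let E := Fintype.equivOfCardEq hcard
  refine ⟨fun j => (E j).1, fun j h => ?_, ?_⟩
  · exact (Fin.cast h (E j).2).elim0
  · rw [Equiv.sum_comp E (fun p => e p.1), Fintype.sum_sigma]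
    simp

/-- Rounds `w x * z` to integers of exact total `z`, supported where `w` is. Values are rounded down
and `x₀` absorbs the accumulated error. -/
theorem exists_shift [DecidableEq d] {w : d → ℝ} (hw1 : ∑ x, w x = 1) {x₀ : d} (h₀ : w x₀ ≠ 0)
    (z : ℤ) : ∃ s : d → ℤ, ∑ x, s x = z ∧ (∀ x, w x = 0 → s x = 0) ∧
      ∀ x, (s x : ℝ) ≤ w x * z + Fintype.card d := by
  let s : d → ℤ := fun x => ⌊w x * z⌋
  have hs : ∑ x, s x = ∑ x ∈ Finset.univ.erase x₀, s x + s x₀ :=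
    (Finset.sum_erase_add _ _ (Finset.mem_univ x₀)).symm
  refine ⟨Function.update s x₀ (z - ∑ x ∈ Finset.univ.erase x₀, s x), ?_, fun x hx => ?_,
    fun x => ?_⟩
  · rw [← Finset.sum_erase_add _ _ (Finset.mem_univ x₀), Function.update_self,
      Finset.sum_congr rfl fun x hx => Function.update_of_ne (Finset.ne_of_mem_erase hx) _ s]
    ring
  · rw [Function.update_of_ne (by rintro rfl; exact h₀ hx)]
    simp [s, hx]
  · by_cases hx : x = x₀
    · subst hx
      rw [Function.update_self]
      have h1 : ∑ y ∈ Finset.univ.erase x, (w y * z - 1) ≤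
          ((∑ y ∈ Finset.univ.erase x, s y : ℤ) : ℝ) := by
        push_cast
        exact Finset.sum_le_sum fun y _ => (Int.sub_one_lt_floor _).le
      have h2 : ∑ y ∈ Finset.univ.erase x, w y = 1 - w x := by
        rw [← hw1, ← Finset.sum_erase_add _ _ (Finset.mem_univ x)]
        ring
      rw [Finset.sum_sub_distrib, ← Finset.sum_mul, h2] at h1
      simp only [Finset.sum_const, nsmul_eq_mul, mul_one] at h1
      have h3 : ((Finset.univ.erase x).card : ℝ) ≤ Fintype.card d := by
        exact_mod_cast Finset.card_le_univ _
      push_cast at h1 ⊢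
      linarith
    · rw [Function.update_of_ne hx]
      have := Int.floor_le (w x * z)
      have h3 : (0 : ℝ) ≤ Fintype.card d := Nat.cast_nonneg _
      linarith

/-- The fidelity of the optimal cloner from `n` to `m` copies is exponentially close to `1` in
`n ^ 2 / m`. -/
theorem exists_le_cloneOverlap (hc : ∑ x, Complex.normSq (c x) = 1) :
    ∃ κ : ℝ, 0 < κ ∧ ∃ n₀ : ℕ, ∀ n m : ℕ, n₀ ≤ n → ∃ μ,
      1 - Fintype.card d * Real.exp (-(κ * (n ^ 2 / m))) ≤ cloneOverlap e c n m μ := by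
  classical
  set w : d → ℝ := fun x => Complex.normSq (c x) with hw
  have hw0 : ∀ x, 0 ≤ w x := fun x => Complex.normSq_nonneg _
  have hwne : ∀ x, w x ≠ 0 ↔ c x ≠ 0 := fun x => by simp [hw]
  have hwle : ∀ x, w x ≤ 1 := fun x => by
    rw [← hc]
    exact Finset.single_le_sum (f := w) (fun x _ => hw0 x) (Finset.mem_univ x)
  obtain ⟨x₀, hx₀⟩ : ∃ x, w x ≠ 0 := by
    by_contra h
    push Not at h
    simp [h] at hc
  obtain ⟨xp, hxp, hmin⟩ := Finset.exists_min_image (Finset.univ.filter fun x => w x ≠ 0) w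
    ⟨x₀, by simp [hx₀]⟩
  simp only [Finset.mem_filter, Finset.mem_univ, true_and] at hxp hmin
  set p := w xp with hp
  have hp0 : 0 < p := lt_of_le_of_ne (hw0 _) hxp.symm
  -- Half of the margin `p * n` is reserved for the rounding error `card d`, half for fluctuations.
  obtain ⟨n₀, hn₀⟩ := exists_nat_ge (2 * Fintype.card d / p)
  refine ⟨p ^ 2 / 16, by positivity, n₀, fun n m hn => ?_⟩
  have hn' : (Fintype.card d : ℝ) ≤ p * n / 2 := by
    have h1 : 2 * Fintype.card d / p ≤ (n : ℝ) := hn₀.trans (by exact_mod_cast hn)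
    rw [div_le_iff₀ hp0] at h1
    linarith
  obtain ⟨s, hs1, hs2, hs3⟩ := exists_shift hc hx₀ ((m : ℤ) - n)
  -- The shift is the energy of `m - n` particles in typical proportions; a negative `s x` stands
  -- for particles to be added.
  refine ⟨∑ x, s x * e x, ?_⟩
  let g : d → d → ℝ := fun x y => w x - if y = x then 1 else 0
  have hdev : ∀ x, ∑ a : Fin m → d with p * n / 2 ≤ ∑ j, g x (a j), ∏ j, w (a j) ≤
      Real.exp (-(p ^ 2 / 16 * (n ^ 2 / m))) := by
    intro x
    refine (sum_filter_prod_le_exp hw0 hc (f := g x) ?_ ?_ m (by positivity)).trans_eq ?_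
    · simp [g, mul_sub, ← Finset.sum_mul, hc]
    · intro y
      have h1 := hw0 x
      have h2 := hwle x
      simp only [g]
      rw [abs_le]
      split_ifs <;> constructor <;> linarith
    · congr 1
      ring
  -- If no state is underpopulated by `p * n / 2`, then `s x` particles can be removed from each
  -- `x`, leaving an `n`-particle configuration. Working with occupation numbers avoids any
  -- assumption on commensurability of the energies.
  have hgood : ∀ a : Fin m → d, (∏ j, w (a j)) ≠ 0 → (∀ x, ∑ j, g x (a j) < p * n / 2) →
      ∃ a' : Fin n → d, totalAmplitude c a' ≠ 0 ∧
        totalEnergy e a = totalEnergy e a' + ∑ x, s x * e x := by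
    intro a ha hlt
    have ha := Finset.prod_ne_zero_iff.1 ha
    let N : d → ℕ := fun x => (Finset.univ.filter fun j => a j = x).card
    have hg : ∀ x, ∑ j, g x (a j) = m * w x - N x := fun x => by
      simp [g, N, Finset.sum_sub_distrib]
    have hN0 : ∀ x, w x = 0 → N x = 0 := fun x hx => by
      refine Finset.card_eq_zero.2 (Finset.filter_eq_empty_iff.2 fun j _ h => ?_)
      exact ha j (Finset.mem_univ _) (h ▸ hx)
    have hle : ∀ x, s x ≤ N x := by
      intro x
      by_cases hx : w x = 0
      · rw [hs2 x hx]
        exact Int.natCast_nonneg _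
      · have h1 := hlt x
        rw [hg] at h1
        have h2 := hs3 x
        push_cast at h2
        have h3 : p * n ≤ w x * n := mul_le_mul_of_nonneg_right (hmin x hx) (Nat.cast_nonneg n)
        have h4 : (s x : ℝ) ≤ N x := by linarith
        exact_mod_cast h4
    have hNsum : ∑ x, N x = m := by
      have := Finset.card_eq_sum_card_fiberwise (f := a) (s := Finset.univ) (t := Finset.univ)
        (fun _ _ => Finset.mem_coe.2 (Finset.mem_univ _))
      simpa [N] using this.symm
    have hcast : ∀ x, (((N x - s x).toNat : ℕ) : ℤ) = N x - s x := fun x =>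
      Int.toNat_of_nonneg (sub_nonneg.2 (hle x))
    obtain ⟨a', h1, h2⟩ := exists_card_fiber_eq (e := e) (fun x => (N x - s x).toNat) (n := n) (by
      zify
      simp_rw [hcast]
      rw [Finset.sum_sub_distrib, hs1, ← Nat.cast_sum, hNsum]
      ring)
    refine ⟨a', Finset.prod_ne_zero_iff.2 fun j _ => (hwne _).1 fun h0 => h1 j ?_, ?_⟩
    · rw [hN0 _ h0, hs2 _ h0]
      rfl
    · have hea : totalEnergy e a = ∑ x, (N x : ℝ) * e x := by
        rw [totalEnergy, ← Finset.sum_fiberwise_of_maps_to (s := Finset.univ) (t := Finset.univ)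
          (g := a) (fun _ _ => Finset.mem_univ _)]
        refine Finset.sum_congr rfl fun x _ => ?_
        rw [Finset.sum_congr rfl fun j hj => by rw [(Finset.mem_filter.1 hj).2]]
        simp [N]
      have hcastR : ∀ x, (((N x - s x).toNat : ℕ) : ℝ) = N x - s x := fun x => by
        exact_mod_cast congrArg (Int.cast : ℤ → ℝ) (hcast x)
      rw [hea, totalEnergy, h2, ← Finset.sum_add_distrib]
      refine Finset.sum_congr rfl fun x _ => ?_
      rw [hcastR]
      ring
  have hP0 : ∀ a : Fin m → d, 0 ≤ ∏ j, w (a j) := fun a => Finset.prod_nonneg fun j _ => hw0 _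
  rw [cloneOverlap, spectralOverlap, sub_le_iff_le_add', ← sum_prod_eq_one hc m,
    ← Finset.sum_filter_add_sum_filter_not Finset.univ (fun a : Fin m → d =>
      ∃ a' : Fin n → d, totalAmplitude c a' ≠ 0 ∧
        totalEnergy e a = totalEnergy e a' + ∑ x, s x * e x), add_comm]
  simp_rw [normSq_totalAmplitude]
  refine add_le_add ?_ le_rfl
  -- Union bound over the states `x` that may be underpopulated.
  calc _ ≤ ∑ a : Fin m → d, ∑ x, if p * n / 2 ≤ ∑ j, g x (a j) then ∏ j, w (a j) else 0 := by
        rw [Finset.sum_filter]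
        refine Finset.sum_le_sum fun a _ => ?_
        have hterm : ∀ x ∈ Finset.univ,
            0 ≤ if p * n / 2 ≤ ∑ j, g x (a j) then ∏ j, w (a j) else 0 := fun x _ => by
          split_ifs
          exacts [hP0 a, le_rfl]
        split_ifs with h
        · exact Finset.sum_nonneg hterm
        · change ∏ j, w (a j) ≤ _
          by_cases h0 : ∏ j, w (a j) = 0
          · exact h0.le.trans (Finset.sum_nonneg hterm)
          · obtain ⟨x, hx⟩ : ∃ x, p * n / 2 ≤ ∑ j, g x (a j) := by
              by_contra hcon
              push Not at hcon
              exact h (hgood a h0 hcon)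
            refine le_trans ?_ (Finset.single_le_sum hterm (Finset.mem_univ x))
            rw [if_pos hx]
    _ = ∑ x, ∑ a : Fin m → d with p * n / 2 ≤ ∑ j, g x (a j), ∏ j, w (a j) := by
        rw [Finset.sum_comm]
        simp_rw [Finset.sum_filter]
    _ ≤ ∑ _x : d, Real.exp (-(p ^ 2 / 16 * (n ^ 2 / m))) := Finset.sum_le_sum fun x _ => hdev x
    _ = _ := by simp

end Overlap

/-! ### Group sizes -/

section Sizes

theorem Division.nonempty_groups {N M : ℕ} (D : Division N M) (hN : 0 < N) :
    Nonempty (Fin D.groups) := by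
  by_contra h
  rw [not_nonempty_iff] at h
  have := D.sum_inSize
  simp at this
  omega

/-- The bound away from `1` needs a group with strictly more outputs than inputs, which the uniform
constants alone do not give when `δ = 0`. -/
theorem Division.exists_inSize_lt_outSize {N M : ℕ} (D : Division N M) (h : N < M) :
    ∃ i, D.inSize i < D.outSize i := by
  by_contra hcon
  push Not at hcon
  have := Finset.sum_le_sum fun i (_ : i ∈ Finset.univ) => hcon i
  rw [D.sum_inSize, D.sum_outSize] at this
  omega

variable {N M : ℕ → ℕ} {β δ : ℝ}

theorem tendsto_rpow_natCast (hN : Tendsto N atTop atTop) {s : ℝ} (hs : 0 < s) :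
    Tendsto (fun k => (N k : ℝ) ^ s) atTop atTop :=
  (tendsto_rpow_atTop hs).comp (tendsto_natCast_atTop_atTop.comp hN)

theorem eventually_one_le_natCast (hN : Tendsto N atTop atTop) : ∀ᶠ k in atTop, (1 : ℝ) ≤ N k := by
  filter_upwards [hN.eventually_ge_atTop 1] with k hk
  exact_mod_cast hk

theorem HasReplicationExponent.exists_bounds (hδ : 0 ≤ δ) (hN : Tendsto N atTop atTop)
    (h : HasReplicationExponent N M δ) :
    ∃ a b : ℝ, 0 < a ∧ 0 < b ∧ ∀ᶠ k in atTop,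
      a * (N k : ℝ) ^ δ ≤ (M k : ℝ) / N k ∧ (M k : ℝ) / N k ≤ b * (N k : ℝ) ^ δ := by
  obtain ⟨hlt, hO, hO'⟩ := h
  obtain ⟨b, hb, hbd⟩ := hO.exists_pos
  obtain ⟨a, ha, had⟩ := hO'.exists_pos
  -- The summand `1` accounts for the `N` in `M = N + (M - N)`, since `1 ≤ N ^ δ`.
  refine ⟨a⁻¹, 1 + b, by positivity, by positivity, ?_⟩
  filter_upwards [hlt, hbd.bound, had.bound, eventually_one_le_natCast hN] with k h1 h2 h3 h4
  have hx : (0 : ℝ) < N k := by linarith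
  have h1' : (N k : ℝ) < M k := by exact_mod_cast h1
  rw [Real.norm_of_nonneg (by linarith : (0 : ℝ) ≤ (M k : ℝ) - N k)] at h2 h3
  rw [Real.norm_of_nonneg (by positivity : (0 : ℝ) ≤ (N k : ℝ) ^ (1 + δ)), Real.rpow_add hx,
    Real.rpow_one] at h2 h3
  have h5 : 1 ≤ (N k : ℝ) ^ δ := Real.one_le_rpow h4 hδ
  rw [le_div_iff₀ hx, div_le_iff₀ hx, inv_mul_eq_div, div_mul_eq_mul_div, div_le_iff₀ ha]
  constructor
  · nlinarith
  · nlinarith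

variable {D : ∀ k, Division (N k) (M k)}

theorem HasGroupExponent.groupsGrowFasterThan_of_lt (hN : Tendsto N atTop atTop)
    (hD : HasGroupExponent D β) (h : δ < β) : GroupsGrowFasterThan D δ := by
  obtain ⟨c, c', hc, hc', hev⟩ := hD
  intro R
  filter_upwards [hev, eventually_one_le_natCast hN,
    (tendsto_rpow_natCast hN (sub_pos.2 h)).eventually_ge_atTop (R / c)] with k h1 h2 h3 i
  have hx : (0 : ℝ) < N k := by linarith
  refine le_trans ?_ (h1 i).1
  rw [div_le_iff₀ hc] at h3
  calc R * (N k : ℝ) ^ δ ≤ ((N k : ℝ) ^ (β - δ) * c) * (N k : ℝ) ^ δ := by gcongr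
    _ = c * ((N k : ℝ) ^ (β - δ) * (N k : ℝ) ^ δ) := by ring
    _ = c * (N k : ℝ) ^ β := by rw [← Real.rpow_add hx, sub_add_cancel]

theorem HasGroupExponent.lt_of_groupsGrowFasterThan (hN : Tendsto N atTop atTop)
    (hD : HasGroupExponent D β) (h : GroupsGrowFasterThan D δ) : δ < β := by
  obtain ⟨c, c', hc, hc', hev⟩ := hD
  by_contra hle
  push Not at hle
  obtain ⟨k, h1, h2, h3⟩ :=
    (hev.and ((eventually_one_le_natCast hN).and (h (c' + 1)))).exists
  have hx : (0 : ℝ) < N k := by linarith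
  obtain ⟨i⟩ := (D k).nonempty_groups (by exact_mod_cast hx)
  have h4 := (h1 i).2.1
  have h5 := h3 i
  have h6 : (N k : ℝ) ^ β ≤ (N k : ℝ) ^ δ := Real.rpow_le_rpow_of_exponent_le h2 hle
  have h7 : 0 < (N k : ℝ) ^ δ := by positivity
  nlinarith

theorem HasGroupExponent.exists_le_interactionSize (hδ : 0 ≤ δ) (hN : Tendsto N atTop atTop)
    (hrep : HasReplicationExponent N M δ) (hD : HasGroupExponent D β) :
    ∃ A : ℝ, 0 < A ∧ ∀ᶠ k in atTop, A * (N k : ℝ) ^ (β + δ) ≤ (D k).interactionSize := by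
  obtain ⟨a, b, ha, hb, hab⟩ := hrep.exists_bounds hδ hN
  obtain ⟨c, c', hc, hc', hev⟩ := hD
  refine ⟨c * (c * a), by positivity, ?_⟩
  filter_upwards [hab, hev, eventually_one_le_natCast hN] with k h1 h2 h3
  have hx : (0 : ℝ) < N k := by linarith
  obtain ⟨i⟩ := (D k).nonempty_groups (by exact_mod_cast hx)
  obtain ⟨h4, -, h5, -⟩ := h2 i
  have h6 : (D k).outSize i ≤ (D k).interactionSize :=
    (le_max_right _ _).trans
      (Finset.le_sup (f := fun i => max ((D k).inSize i) ((D k).outSize i)) (Finset.mem_univ i))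
  calc c * (c * a) * (N k : ℝ) ^ (β + δ)
      = c * ((c * (N k : ℝ) ^ β) * (a * (N k : ℝ) ^ δ)) := by rw [Real.rpow_add hx]; ring
    _ ≤ c * ((D k).inSize i * ((M k : ℝ) / N k)) := by gcongr; exact h1.1
    _ ≤ (D k).outSize i := h5
    _ ≤ _ := by exact_mod_cast h6

theorem HasGroupExponent.exists_interactionSize_le (hδ : 0 ≤ δ) (hN : Tendsto N atTop atTop)
    (hrep : HasReplicationExponent N M δ) (hD : HasGroupExponent D β) :
    ∃ A : ℝ, 0 < A ∧ ∀ᶠ k in atTop, (D k).interactionSize ≤ A * (N k : ℝ) ^ (β + δ) := by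
  obtain ⟨a, b, ha, hb, hab⟩ := hrep.exists_bounds hδ hN
  obtain ⟨c, c', hc, hc', hev⟩ := hD
  refine ⟨c' + c' * (c' * b), by positivity, ?_⟩
  filter_upwards [hab, hev, eventually_one_le_natCast hN] with k h1 h2 h3
  have hx : (0 : ℝ) < N k := by linarith
  obtain ⟨i₀⟩ := (D k).nonempty_groups (by exact_mod_cast hx)
  obtain ⟨i, -, hi⟩ := Finset.exists_mem_eq_sup Finset.univ ⟨i₀, Finset.mem_univ _⟩
    fun i => max ((D k).inSize i) ((D k).outSize i)
  rw [Division.interactionSize, hi, Nat.cast_max]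
  obtain ⟨-, h4, -, h5⟩ := h2 i
  have h6 : ((D k).inSize i : ℝ) ≤ c' * (N k : ℝ) ^ (β + δ) := by
    refine h4.trans ?_
    gcongr
    linarith
  have h7 : ((D k).outSize i : ℝ) ≤ c' * (c' * b) * (N k : ℝ) ^ (β + δ) := by
    calc ((D k).outSize i : ℝ) ≤ c' * ((D k).inSize i * ((M k : ℝ) / N k)) := h5
      _ ≤ c' * ((c' * (N k : ℝ) ^ β) * (b * (N k : ℝ) ^ δ)) := by gcongr; exact h1.2
      _ = c' * (c' * b) * (N k : ℝ) ^ (β + δ) := by rw [Real.rpow_add hx]; ring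
  have h8 : 0 ≤ c' * (N k : ℝ) ^ (β + δ) := by positivity
  have h9 : 0 ≤ c' * (c' * b) * (N k : ℝ) ^ (β + δ) := by positivity
  rw [add_mul]
  exact max_le (by linarith) (by linarith)

theorem sq_div_sq_isTheta (hδ : 0 ≤ δ) (hN : Tendsto N atTop atTop)
    (hrep : HasReplicationExponent N M δ) :
    (fun k => (M k : ℝ) ^ 2 / (N k : ℝ) ^ 2) =Θ[atTop] fun k => (N k : ℝ) ^ (2 * δ) := by
  obtain ⟨a, b, ha, hb, hab⟩ := hrep.exists_bounds hδ hN
  have hpow : ∀ k, (N k : ℝ) ^ (2 * δ) = ((N k : ℝ) ^ δ) ^ 2 := fun k => by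
    rw [mul_comm, ← Real.rpow_mul_natCast (Nat.cast_nonneg _)]
    norm_num
  constructor
  · refine IsBigO.of_bound (b ^ 2) ?_
    filter_upwards [hab] with k h
    rw [Real.norm_of_nonneg (by positivity), Real.norm_of_nonneg (by positivity), hpow,
      ← div_pow, ← mul_pow]
    gcongr
    exact h.2
  · refine IsBigO.of_bound (a⁻¹ ^ 2) ?_
    filter_upwards [hab] with k h
    rw [Real.norm_of_nonneg (by positivity), Real.norm_of_nonneg (by positivity), hpow,
      ← div_pow, ← mul_pow]
    gcongr
    rw [inv_mul_eq_div, le_div_iff₀ ha, mul_comm]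
    exact h.1

/-- As `δ ≥ 0`, the outputs, of order `N ^ (β + δ)`, set the size of a group. -/
theorem HasGroupExponent.interactionSize_isTheta (hδ : 0 ≤ δ) (hN : Tendsto N atTop atTop)
    (hrep : HasReplicationExponent N M δ) (hD : HasGroupExponent D β) :
    (fun k => ((D k).interactionSize : ℝ)) =Θ[atTop] fun k => (N k : ℝ) ^ (β + δ) := by
  obtain ⟨A, hA, h1⟩ := hD.exists_le_interactionSize hδ hN hrep
  obtain ⟨B, hB, h2⟩ := hD.exists_interactionSize_le hδ hN hrep
  constructor
  · refine IsBigO.of_bound B ?_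
    filter_upwards [h2] with k h
    rwa [Real.norm_of_nonneg (by positivity), Real.norm_of_nonneg (by positivity)]
  · refine IsBigO.of_bound A⁻¹ ?_
    filter_upwards [h1] with k h
    rwa [Real.norm_of_nonneg (by positivity), Real.norm_of_nonneg (by positivity),
      inv_mul_eq_div, le_div_iff₀ hA, mul_comm]

theorem isLittleO_rpow_natCast_iff (hN : Tendsto N atTop atTop) {p q : ℝ} :
    ((fun k => (N k : ℝ) ^ p) =o[atTop] fun k => (N k : ℝ) ^ q) ↔ p < q := by
  constructor
  · intro h
    by_contra hle
    push Not at hle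
    have hO : (fun k => (N k : ℝ) ^ q) =O[atTop] fun k => (N k : ℝ) ^ p := by
      refine IsBigO.of_bound 1 ?_
      filter_upwards [eventually_one_le_natCast hN] with k hk
      rw [Real.norm_of_nonneg (by positivity), Real.norm_of_nonneg (by positivity), one_mul]
      exact Real.rpow_le_rpow_of_exponent_le hk hle
    refine isLittleO_irrefl ?_ (h.trans_isBigO hO)
    refine Eventually.frequently ?_
    filter_upwards [eventually_one_le_natCast hN] with k hk
    exact (Real.rpow_pos_of_pos (by linarith) _).ne'
  · intro h
    have hpos : ∀ᶠ k in atTop, (0 : ℝ) < N k := by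
      filter_upwards [eventually_one_le_natCast hN] with k hk
      linarith
    refine (isLittleO_iff_tendsto' ?_).2 ?_
    · filter_upwards [hpos] with k hk h0
      exact absurd h0 (Real.rpow_pos_of_pos hk _).ne'
    · refine ((tendsto_rpow_neg_atTop (sub_pos.2 h)).comp
        (tendsto_natCast_atTop_atTop.comp hN)).congr' ?_
      filter_upwards [hpos] with k hk
      simp only [Function.comp_apply]
      rw [neg_sub, Real.rpow_sub hk]

theorem HasGroupExponent.isLittleO_interactionSize_iff (hδ : 0 ≤ δ) (hN : Tendsto N atTop atTop)
    (hrep : HasReplicationExponent N M δ) (hD : HasGroupExponent D β) :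
    ((fun k => (M k : ℝ) ^ 2 / (N k : ℝ) ^ 2) =o[atTop] fun k => ((D k).interactionSize : ℝ)) ↔
      δ < β := by
  rw [(sq_div_sq_isTheta hδ hN hrep).isLittleO_congr_left,
    (hD.interactionSize_isTheta hδ hN hrep).isLittleO_congr_right, isLittleO_rpow_natCast_iff hN]
  constructor <;> intro h <;> linarith

/-! ### Balanced divisions -/

/-- Part `i` of a division of `n` objects into `g` parts whose sizes differ by at most `1`. -/
def balancedSize (n g : ℕ) (i : Fin g) : ℕ := n / g + if (i : ℕ) < n % g then 1 else 0

theorem sum_balancedSize (n : ℕ) {g : ℕ} (hg : 0 < g) : ∑ i, balancedSize n g i = n := by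
  simp only [balancedSize, Finset.sum_add_distrib, Finset.sum_const, Finset.card_univ,
    Fintype.card_fin, smul_eq_mul]
  have : ∑ i : Fin g, (if (i : ℕ) < n % g then 1 else 0) = n % g := by
    rw [Fin.sum_univ_eq_sum_range (fun i => if i < n % g then 1 else 0) g, ← Finset.sum_filter]
    have hf : (Finset.range g).filter (fun i => i < n % g) = Finset.range (n % g) := by
      ext i
      have := Nat.mod_lt n hg
      simp only [Finset.mem_filter, Finset.mem_range]
      omega
    simp [hf]
  rw [this, Nat.div_add_mod]

/-- The quotient is at least `1`, so rounding costs at most a factor `2`. -/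
theorem balancedSize_bounds {n g : ℕ} (hg : 0 < g) (hgn : g ≤ n) (i : Fin g) :
    (n : ℝ) / g / 2 ≤ balancedSize n g i ∧ (balancedSize n g i : ℝ) ≤ 2 * (n / g) := by
  have hg' : (0 : ℝ) < g := by exact_mod_cast hg
  have h1 : 1 ≤ n / g := (Nat.one_le_div_iff hg).2 hgn
  have h2 : n < g * (n / g + 1) := Nat.lt_mul_div_succ n hg
  have h3 : g * (n / g) ≤ n := Nat.mul_div_le n g
  have h4 : n / g ≤ balancedSize n g i := Nat.le_add_right _ _
  have h5 : balancedSize n g i ≤ n / g + 1 := by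
    rw [balancedSize]
    split_ifs <;> omega
  have h1' : (1 : ℝ) ≤ ((n / g : ℕ) : ℝ) := by exact_mod_cast h1
  have h2' : (n : ℝ) ≤ g * (((n / g : ℕ) : ℝ) + 1) := by exact_mod_cast h2.le
  have h3' : (g : ℝ) * ((n / g : ℕ) : ℝ) ≤ n := by exact_mod_cast h3
  have h4' : ((n / g : ℕ) : ℝ) ≤ balancedSize n g i := by exact_mod_cast h4
  have h5' : (balancedSize n g i : ℝ) ≤ ((n / g : ℕ) : ℝ) + 1 := by exact_mod_cast h5
  have h6 : (n : ℝ) / g ≤ ((n / g : ℕ) : ℝ) + 1 := by rwa [div_le_iff₀ hg', mul_comm]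
  have h7 : ((n / g : ℕ) : ℝ) ≤ (n : ℝ) / g := by rwa [le_div_iff₀ hg', mul_comm]
  constructor <;> linarith

/-- The division into `g` groups with input sizes, and output sizes, that differ by at most `1`. -/
def balancedDivision (N M : ℕ) {g : ℕ} (hg : 0 < g) : Division N M where
  groups := g
  inSize := balancedSize N g
  outSize := balancedSize M g
  sum_inSize := sum_balancedSize N hg
  sum_outSize := sum_balancedSize M hg

theorem exists_division_hasGroupExponent (hN : Tendsto N atTop atTop)
    (hNM : ∀ᶠ k in atTop, N k < M k) (hβ0 : 0 ≤ β) (hβ1 : β ≤ 1) :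
    ∃ D : ∀ k, Division (N k) (M k), HasGroupExponent D β := by
  -- About `N ^ (1 - β)` groups; the `max` only keeps the number positive for every `k`. In the
  -- constants `1 / 4` and `4`, one factor `2` comes from balancing the inputs and another from the
  -- floor or from balancing the outputs.
  refine ⟨fun k => balancedDivision (N k) (M k) (g := max 1 ⌊(N k : ℝ) ^ (1 - β)⌋₊) (by simp),
    1 / 4, 4, by norm_num, by norm_num, ?_⟩
  filter_upwards [eventually_one_le_natCast hN, hNM] with k hk hlt i
  have hx : (0 : ℝ) < N k := by linarith
  have hM : (0 : ℝ) < M k := by exact_mod_cast (Nat.zero_le _).trans_lt hlt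
  have hy1 : 1 ≤ (N k : ℝ) ^ (1 - β) := Real.one_le_rpow hk (by linarith)
  have hyN : (N k : ℝ) ^ (1 - β) ≤ N k := by
    conv_rhs => rw [← Real.rpow_one (N k : ℝ)]
    exact Real.rpow_le_rpow_of_exponent_le hk (by linarith)
  have hyβ : (N k : ℝ) = (N k : ℝ) ^ (1 - β) * (N k : ℝ) ^ β := by
    rw [← Real.rpow_add hx, sub_add_cancel, Real.rpow_one]
  have hf1 : 1 ≤ ⌊(N k : ℝ) ^ (1 - β)⌋₊ := Nat.one_le_floor_iff _ |>.2 hy1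
  change Fin (max 1 ⌊(N k : ℝ) ^ (1 - β)⌋₊) at i
  change _ ≤ (balancedSize (N k) _ i : ℝ) ∧ (balancedSize (N k) _ i : ℝ) ≤ _ ∧
    1 / 4 * ((balancedSize (N k) _ i : ℝ) * _) ≤ (balancedSize (M k) _ i : ℝ) ∧
    (balancedSize (M k) _ i : ℝ) ≤ 4 * ((balancedSize (N k) _ i : ℝ) * _)
  generalize hg : max 1 ⌊(N k : ℝ) ^ (1 - β)⌋₊ = g at i ⊢
  have hg1 : 1 ≤ g := by omega
  have hg1' : (0 : ℝ) < g := by exact_mod_cast hg1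
  have hgy : (g : ℝ) ≤ (N k : ℝ) ^ (1 - β) := by
    rw [← hg, max_eq_right hf1]
    exact Nat.floor_le (by positivity)
  have hyg : (N k : ℝ) ^ (1 - β) ≤ 2 * g := by
    have h1 := (Nat.lt_floor_add_one ((N k : ℝ) ^ (1 - β))).le
    have h2 : (1 : ℝ) ≤ g := by exact_mod_cast hg1
    rw [max_eq_right hf1] at hg
    rw [hg] at h1
    linarith
  have hgN : g ≤ N k := by exact_mod_cast hgy.trans hyN
  obtain ⟨n1, n2⟩ := balancedSize_bounds hg1 hgN i
  obtain ⟨m1, m2⟩ := balancedSize_bounds hg1 (hgN.trans hlt.le) i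
  have hβpos : 0 < (N k : ℝ) ^ β := Real.rpow_pos_of_pos hx _
  have e1 : (N k : ℝ) ^ β ≤ N k / g := by
    rw [le_div_iff₀ hg1', mul_comm]
    nlinarith
  have e2 : (N k : ℝ) / g ≤ 2 * (N k : ℝ) ^ β := by
    rw [div_le_iff₀ hg1']
    nlinarith
  have hq : (N k : ℝ) / g * (M k / N k) = M k / g := by field_simp
  have r1 := mul_le_mul_of_nonneg_right n1 (by positivity : (0 : ℝ) ≤ M k / N k)
  have r2 := mul_le_mul_of_nonneg_right n2 (by positivity : (0 : ℝ) ≤ M k / N k)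
  rw [div_mul_eq_mul_div, hq] at r1
  rw [mul_assoc, hq] at r2
  refine ⟨?_, ?_, ?_, ?_⟩ <;> linarith

end Sizes

/-! ### Superreplication -/

section Superreplication

variable {d : Type*} [Fintype d] [DecidableEq d] {H : Matrix d d ℂ} {ψ : d → ℂ}
  {U : Matrix d d ℂ} {e : d → ℝ} {c : d → ℂ} {N M : ℕ → ℕ} {β δ : ℝ}
  {D : ∀ k, Division (N k) (M k)}

theorem lt_of_tendsto_divideAndCloneFidelity (hU : Uᴴ * U = 1)
    (hstate : ∀ t, clockState H ψ t = U *ᵥ clockVec e c t)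
    (hc : ∑ x, Complex.normSq (c x) = 1) (hne : ∃ x y, c x ≠ 0 ∧ c y ≠ 0 ∧ e x < e y)
    (hδ : 0 ≤ δ) (hN : Tendsto N atTop atTop) (hrep : HasReplicationExponent N M δ)
    (hD : HasGroupExponent D β) (C : ∀ k i, ProbCloner H ψ ((D k).inSize i) ((D k).outSize i))
    (h : Tendsto (fun k => divideAndCloneFidelity (D k) (C k)) atTop (nhds 1)) : δ < β := by
  by_contra hle
  push Not at hle
  obtain ⟨a, b, ha, hb, hab⟩ := hrep.exists_bounds hδ hN
  obtain ⟨c₁, c₂, hc₁, hc₂, hev⟩ := hD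
  -- This ratio bounds `n ^ 2 / m` in every group once `β ≤ δ`.
  obtain ⟨η, hη, hbound⟩ := exists_cloneOverlap_le hc hne (c₂ ^ 2 / (c₁ * (c₁ * a)))
  have hev' : ∀ᶠ k in atTop, divideAndCloneFidelity (D k) (C k) ≤ 1 - η := by
    filter_upwards [hab, hev, hrep.1, eventually_one_le_natCast hN] with k h1 h2 h3 h4
    have hx : (0 : ℝ) < N k := by linarith
    obtain ⟨i, hi⟩ := (D k).exists_inSize_lt_outSize h3
    refine (divideAndCloneFidelity_le (D k) (C k) hU hstate hc i).trans
      ((C k i).fidelity_le hU hstate fun μ => hbound _ _ μ hi ?_)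
    obtain ⟨g1, g2, g3, -⟩ := h2 i
    have h5 : c₁ * (c₁ * a) * (N k : ℝ) ^ (β + δ) ≤ (D k).outSize i := by
      calc c₁ * (c₁ * a) * (N k : ℝ) ^ (β + δ)
          = c₁ * ((c₁ * (N k : ℝ) ^ β) * (a * (N k : ℝ) ^ δ)) := by rw [Real.rpow_add hx]; ring
        _ ≤ c₁ * ((D k).inSize i * ((M k : ℝ) / N k)) := by gcongr; exact h1.1
        _ ≤ (D k).outSize i := g3
    calc ((D k).inSize i : ℝ) ^ 2 ≤ (c₂ * (N k : ℝ) ^ β) ^ 2 := by gcongr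
      _ = c₂ ^ 2 * (N k : ℝ) ^ (β + β) := by rw [Real.rpow_add hx]; ring
      _ ≤ c₂ ^ 2 * (N k : ℝ) ^ (β + δ) := by
          gcongr
      _ = c₂ ^ 2 / (c₁ * (c₁ * a)) * (c₁ * (c₁ * a) * (N k : ℝ) ^ (β + δ)) := by field_simp
      _ ≤ _ := by gcongr
  have := le_of_tendsto h hev'
  linarith

theorem tendsto_divideAndCloneFidelity (hU : Uᴴ * U = 1)
    (hstate : ∀ t, clockState H ψ t = U *ᵥ clockVec e c t)
    (hc : ∑ x, Complex.normSq (c x) = 1)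
    (hδ : 0 ≤ δ) (hN : Tendsto N atTop atTop) (hrep : HasReplicationExponent N M δ)
    (hD : HasGroupExponent D β) (C : ∀ k i, ProbCloner H ψ ((D k).inSize i) ((D k).outSize i))
    (hC : ∀ k i, (C k i).IsOptimal) (hlt : δ < β) :
    Tendsto (fun k => divideAndCloneFidelity (D k) (C k)) atTop (nhds 1) := by
  obtain ⟨a, b, ha, hb, hab⟩ := hrep.exists_bounds hδ hN
  obtain ⟨c₁, c₂, hc₁, hc₂, hev⟩ := hD
  obtain ⟨κ, hκ, n₀, hκn⟩ := exists_le_cloneOverlap (e := e) hc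
  have hβ : 0 < β := hδ.trans_lt hlt
  -- Chosen so that `A * N ^ (β - δ)` is a lower bound for `κ * (n ^ 2 / m)` in every group.
  set A : ℝ := κ * (c₁ / (c₂ * b)) with hA
  have hA0 : 0 < A := by positivity
  set ε : ℕ → ℝ := fun k => Fintype.card d * Real.exp (-A * (N k : ℝ) ^ (β - δ)) with hε
  have hlim : Tendsto (fun k => (N k : ℝ) * Real.exp (-A * (N k : ℝ) ^ (β - δ))) atTop
      (nhds 0) := by
    refine ((tendsto_rpow_mul_exp_neg_mul_atTop_nhds_zero (1 / (β - δ)) A hA0).comp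
      (tendsto_rpow_natCast hN (sub_pos.2 hlt))).congr fun k => ?_
    simp only [Function.comp_apply]
    rw [← Real.rpow_mul (Nat.cast_nonneg _), mul_one_div_cancel (sub_pos.2 hlt).ne', Real.rpow_one]
  have hlow : Tendsto (fun k => 1 - Fintype.card d / c₁ *
      ((N k : ℝ) * Real.exp (-A * (N k : ℝ) ^ (β - δ)))) atTop (nhds 1) := by
    simpa using (hlim.const_mul (Fintype.card d / c₁ : ℝ)).const_sub 1
  refine tendsto_of_tendsto_of_tendsto_of_le_of_le' hlow tendsto_const_nhds ?_
    (Eventually.of_forall fun k => divideAndCloneFidelity_le_one (D k) (C k) hU hstate hc)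
  have hsmall : ∀ᶠ k in atTop, (Fintype.card d : ℝ) *
      ((N k : ℝ) * Real.exp (-A * (N k : ℝ) ^ (β - δ))) < 1 := by
    have := hlim.const_mul (Fintype.card d : ℝ)
    rw [mul_zero] at this
    exact this.eventually_lt_const one_pos
  filter_upwards [hab, hev, eventually_one_le_natCast hN, hsmall,
    (tendsto_rpow_natCast hN hβ).eventually_ge_atTop (n₀ / c₁)] with k h1 h2 h3 h4 h5
  have hx : (0 : ℝ) < N k := by linarith
  have hβ1 : 1 ≤ (N k : ℝ) ^ β := Real.one_le_rpow h3 hβ.le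
  have hε0 : 0 ≤ ε k := by positivity
  have hε1 : ε k ≤ 1 := by
    refine le_trans ?_ h4.le
    have : Real.exp (-A * (N k : ℝ) ^ (β - δ)) ≤
        (N k : ℝ) * Real.exp (-A * (N k : ℝ) ^ (β - δ)) :=
      le_mul_of_one_le_left (Real.exp_nonneg _) h3
    exact mul_le_mul_of_nonneg_left this (Nat.cast_nonneg _)
  have hfid : ∀ i, 1 - ε k ≤ fidelity H ψ (C k i).op := by
    intro i
    obtain ⟨g1, g2, g3, g4⟩ := h2 i
    have hn : (0 : ℝ) < (D k).inSize i := lt_of_lt_of_le (by positivity) g1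
    have hM : 0 < (M k : ℝ) / N k := lt_of_lt_of_le (by positivity) h1.1
    have hm : (0 : ℝ) < (D k).outSize i := lt_of_lt_of_le (by positivity) g3
    have hn₀ : n₀ ≤ (D k).inSize i := by
      rw [div_le_iff₀ hc₁] at h5
      have : (n₀ : ℝ) ≤ (D k).inSize i := by linarith
      exact_mod_cast this
    obtain ⟨μ, hμ⟩ := hκn _ ((D k).outSize i) hn₀
    refine le_trans ?_ (hμ.trans ((hC k i).cloneOverlap_le_fidelity hU hstate hc μ))
    have hexp : A * (N k : ℝ) ^ (β - δ) ≤
        κ * (((D k).inSize i : ℝ) ^ 2 / (D k).outSize i) := by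
      rw [hA, mul_assoc]
      refine mul_le_mul_of_nonneg_left ?_ hκ.le
      rw [le_div_iff₀ hm]
      calc c₁ / (c₂ * b) * (N k : ℝ) ^ (β - δ) * (D k).outSize i
          ≤ c₁ / (c₂ * b) * (N k : ℝ) ^ (β - δ) *
            (c₂ * ((D k).inSize i * (b * (N k : ℝ) ^ δ))) := by
            gcongr
            refine g4.trans ?_
            gcongr
            exact h1.2
        _ = c₁ * ((N k : ℝ) ^ (β - δ) * (N k : ℝ) ^ δ) * (D k).inSize i := by field_simp
        _ = c₁ * (N k : ℝ) ^ β * (D k).inSize i := by rw [← Real.rpow_add hx, sub_add_cancel]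
        _ ≤ (D k).inSize i * (D k).inSize i := by gcongr
        _ = _ := (sq _).symm
    rw [hε]
    simp only
    gcongr
    linarith
  -- Each group has at least `c₁` inputs. This crude count suffices against the stretched
  -- exponential error; Bernoulli's inequality then bounds the product.
  have hgroups : ((D k).groups : ℝ) ≤ N k / c₁ := by
    rw [le_div_iff₀ hc₁]
    have hsum : ∑ i, ((D k).inSize i : ℝ) = N k := by exact_mod_cast (D k).sum_inSize
    rw [← hsum]
    calc ((D k).groups : ℝ) * c₁ = ∑ _i : Fin (D k).groups, c₁ := by simp
      _ ≤ _ := Finset.sum_le_sum fun i _ => (by nlinarith : c₁ ≤ c₁ * (N k : ℝ) ^ β).trans (h2 i).1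
  calc 1 - Fintype.card d / c₁ * ((N k : ℝ) * Real.exp (-A * (N k : ℝ) ^ (β - δ)))
      = 1 - N k / c₁ * ε k := by rw [hε]; ring
    _ ≤ 1 - (D k).groups * ε k := by gcongr
    _ = 1 + (D k).groups * (1 - ε k - 1) := by ring
    _ ≤ (1 - ε k) ^ (D k).groups := one_add_mul_sub_le_pow (by linarith) _
    _ = ∏ _i : Fin (D k).groups, (1 - ε k) := by simp
    _ ≤ _ := prod_le_divideAndCloneFidelity (D k) (C k) _ (fun _ => sub_nonneg.2 hε1) hfid

end Superreplication

end Superreplication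

theorem mainTheorem6 {d : Type*} [Fintype d] [DecidableEq d]
    (H : Matrix d d ℂ) (hH : H.IsHermitian)
    (ψ : d → ℂ) (hψ : star ψ ⬝ᵥ ψ = 1)
    (hclock : ∀ e : ℂ, H *ᵥ ψ ≠ e • ψ) :
    -- optimal probabilistic cloners exist
    (∀ n m : ℕ, ∃ C : ProbCloner H ψ n m, C.IsOptimal) ∧
    ∀ (N M : ℕ → ℕ) (δ : ℝ), 0 ≤ δ → Tendsto N atTop atTop → HasReplicationExponent N M δ →
      -- exactly the groups that are large compared to `N ^ δ` give superreplication
      (∀ (β : ℝ) (D : ∀ k, Division (N k) (M k)), HasGroupExponent D β →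
        ∀ C : ∀ k i, ProbCloner H ψ ((D k).inSize i) ((D k).outSize i),
          (∀ k i, (C k i).IsOptimal) →
          List.TFAE [
            Tendsto (fun k => divideAndCloneFidelity (D k) (C k)) atTop (nhds 1),
            GroupsGrowFasterThan D δ,
            δ < β,
            (fun k => (M k : ℝ) ^ 2 / (N k : ℝ) ^ 2) =o[atTop]
              fun k => ((D k).interactionSize : ℝ)]) ∧
      -- interactions among `O(M ^ 2 / N ^ (2 - ε))` particles are enough
      (δ < 1 → ∀ ε : ℝ, 0 < ε →
        ∃ (β : ℝ) (D : ∀ k, Division (N k) (M k)), HasGroupExponent D β ∧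
          (fun k => ((D k).interactionSize : ℝ)) =O[atTop]
            (fun k => (M k : ℝ) ^ 2 / (N k : ℝ) ^ (2 - ε)) ∧
          ∀ C : ∀ k i, ProbCloner H ψ ((D k).inSize i) ((D k).outSize i),
            (∀ k i, (C k i).IsOptimal) →
            Tendsto (fun k => divideAndCloneFidelity (D k) (C k)) atTop (nhds 1)) := by
  obtain ⟨U, e, c, hU, hstate, hc, hne⟩ := exists_clockState_eq hH hψ hclock
  refine ⟨exists_isOptimal hU hstate hc, fun N M δ hδ hN hrep => ⟨fun β D hD C hC => ?_, ?_⟩⟩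
  · tfae_have 1 → 3 := lt_of_tendsto_divideAndCloneFidelity hU hstate hc hne hδ hN hrep hD C
    tfae_have 3 → 1 := tendsto_divideAndCloneFidelity hU hstate hc hδ hN hrep hD C hC
    tfae_have 2 → 3 := hD.lt_of_groupsGrowFasterThan hN
    tfae_have 3 → 2 := hD.groupsGrowFasterThan_of_lt hN
    tfae_have 4 ↔ 3 := hD.isLittleO_interactionSize_iff hδ hN hrep
    tfae_finish
  · intro hδ1 ε hε
    -- The bound `β ≤ δ + ε` controls the interaction size, and `β ≤ 1` keeps groups within the
    -- available inputs; `δ < 1` leaves room.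
    obtain ⟨β, hβ, hβε, hβ1⟩ : ∃ β, δ < β ∧ β ≤ δ + ε ∧ β ≤ 1 :=
      ⟨min (δ + ε) 1, lt_min (by linarith) hδ1, min_le_left _ _, min_le_right _ _⟩
    obtain ⟨D, hD⟩ := exists_division_hasGroupExponent hN hrep.1 (hδ.trans hβ.le) hβ1
    refine ⟨β, D, hD, ?_, fun C hC =>
      tendsto_divideAndCloneFidelity hU hstate hc hδ hN hrep hD C hC hβ⟩
    have h1 : (fun k => (N k : ℝ) ^ (β + δ)) =O[atTop]
        fun k => (N k : ℝ) ^ (2 * δ) * (N k : ℝ) ^ ε := by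
      refine IsBigO.of_bound 1 ?_
      filter_upwards [eventually_one_le_natCast hN] with k hk
      have hx : (0 : ℝ) < N k := by linarith
      rw [Real.norm_of_nonneg (by positivity), Real.norm_of_nonneg (by positivity), one_mul,
        ← Real.rpow_add hx]
      exact Real.rpow_le_rpow_of_exponent_le hk (by linarith)
    have h2 : (fun k => (M k : ℝ) ^ 2 / (N k : ℝ) ^ 2 * (N k : ℝ) ^ ε) =ᶠ[atTop]
        fun k => (M k : ℝ) ^ 2 / (N k : ℝ) ^ (2 - ε) := by
      filter_upwards [eventually_one_le_natCast hN] with k hk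
      have hx : (0 : ℝ) < N k := by linarith
      rw [Real.rpow_sub hx, Real.rpow_two]
      field_simp
    exact ((hD.interactionSize_isTheta hδ hN hrep).1.trans h1).trans
      (((sq_div_sq_isTheta hδ hN hrep).2.mul (isBigO_refl _ _)).trans_eventuallyEq h2)
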